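/- Let $p$ be a prime, let $q$ be a power of $p$, and write $\mathbb{F}_q(T)$ for the rational function field. For a finite group $G$, an $L^{\mathrm{gt}}_1(q)$-realization of $G$ is a Galois extension $K/\mathbb{F}_q(T)$ with Galois group isomorphic to $G$ that is geometric (i.e. $K$ and $\mathbb{F}_q(T)$ have the same field of constants), unramified outside of two degree $1$ prime divisors of $\mathbb{F}_q(T)$, and at most tamely ramified over one of these two; $G$ is called $L^{\mathrm{gt}}_1(q)$-realizable if such an extension exists. (i) Assume $p>3$ and let $$f = X^p(X-1) - T\,(X-4)^{p-2}\left(X-\tfrac43\right)^2\in\mathbb{F}_q[T][X].$$ Then the discriminant of $f$ with respect to $X$ is $\mathrm{Disc}(f) = (-1)^{\frac{p+1}{2}}\frac{4}{243}\,T^{p+2}$ (a nonzero constant times $T^{p+2}$), and the splitting field of $f$ over $\mathbb{F}_q(T)$ is an $L^{\mathrm{gt}}_1(q)$-realization of the symmetric group $S_{p+1}$. In particular $S_{p+1}$ is $L^{\mathrm{gt}}_1(q)$-realizable. (ii) If $p=3$, then the splitting field of $X^4+X+T$ over $\mathbb{F}_q(T)$ is an $L^{\mathrm{gt}}_1(q)$-realization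 of $S_4$. -/

import Mathlib

universe u v

open Polynomial

/-- A prime divisor (place) of a function field `K` over `F`, given by its valuation ring:
a valuation ring `O` of `K` with `F ⊆ O ⊊ K`. -/
structure PrimeDivisor (F : Type*) (K : Type*) [Field F] [Field K] [Algebra F K] where
  /-- the valuation ring of the prime divisor -/
  ring : ValuationSubring K
  algebraMap_mem : ∀ c : F, algebraMap F K c ∈ ring
  ne_top : ring ≠ ⊤

namespace PrimeDivisor

noncomputable instance instAlgebraRing {F K : Type*} [Field F] [Field K] [Algebra F K]
    (P : PrimeDivisor F K) : Algebra F P.ring :=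
  ((algebraMap F K).codRestrict P.ring P.algebraMap_mem).toAlgebra

/-- The degree of a prime divisor: the degree over `F` of its residue field. -/
noncomputable def degree {F K : Type*} [Field F] [Field K] [Algebra F K]
    (P : PrimeDivisor F K) : ℕ :=
  Module.finrank F (IsLocalRing.ResidueField P.ring)

section Extension

variable {F K L : Type*} [Field F] [Field K] [Field L]
  [Algebra F K] [Algebra F L] [Algebra K L]

/-- A prime divisor `Q` of `L` lies over the prime divisor `P` of `K` if `O_Q ∩ K = O_P`. -/
def LiesOver (Q : PrimeDivisor F L) (P : PrimeDivisor F K) : Prop :=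
  Q.ring.comap (algebraMap K L) = P.ring

variable (K) in
/-- The ramification index over `K` of a prime divisor `Q` of an extension `L/K`, i.e. the
ramification index of the maximal ideal of `O_Q` in the ring extension `O_Q / (O_Q ∩ K)`. -/
noncomputable def ramificationIdx (Q : PrimeDivisor F L) : ℕ :=
  letI : Algebra (Q.ring.comap (algebraMap K L)) Q.ring :=
    ((algebraMap K L).restrict (Q.ring.comap (algebraMap K L)) Q.ring (fun _ h => h)).toAlgebra
  (IsLocalRing.maximalIdeal Q.ring).ramificationIdx (Q.ring.comap (algebraMap K L))

variable (L) in
/-- `P` is unramified in `L/K`: every prime divisor over `P` has ramification index `1`.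
(We use this only over finite fields `F`, where residue field extensions are separable.) -/
def IsUnramifiedIn (P : PrimeDivisor F K) : Prop :=
  ∀ Q : PrimeDivisor F L, Q.LiesOver P → Q.ramificationIdx K = 1

variable (L) in
/-- `P` is at most tamely ramified in `L/K`: no ramification index over `P` is divisible by
the characteristic. (Again used only over finite fields `F`.) -/
def IsTamelyRamifiedIn (P : PrimeDivisor F K) : Prop :=
  ∀ Q : PrimeDivisor F L, Q.LiesOver P → ¬ ringChar F ∣ Q.ramificationIdx K

end Extension

end PrimeDivisor

/-- An extension `L/K` of function fields over `F` is geometric if `K` and `L` have the same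
field of constants, the field of constants being the algebraic closure of `F` in the field. -/
def IsGeometricExtension (F K L : Type*) [Field F] [Field K] [Field L]
    [Algebra F K] [Algebra F L] [Algebra K L] [IsScalarTower F K L] : Prop :=
  algebraicClosure F L = (algebraicClosure F K).map (IsScalarTower.toAlgHom F K L)

/-- `K/F(T)` is an `L^gt_1`-realization of the group `G` over the finite field `F`: a geometric
Galois extension with group isomorphic to `G`, unramified outside of two prime divisors of
degree 1 of `F(T)`, and at most tamely ramified over one of these two. -/
def IsLgt1Realization (F : Type*) [Field F] [Finite F] (G : Type*) [Group G]
    (K : Type*) [Field K] [Algebra F K] [Algebra (RatFunc F) K]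
    [IsScalarTower F (RatFunc F) K] : Prop :=
  IsGalois (RatFunc F) K ∧
  Nonempty ((K ≃ₐ[RatFunc F] K) ≃* G) ∧
  IsGeometricExtension F (RatFunc F) K ∧
  ∃ P₁ P₂ : PrimeDivisor F (RatFunc F),
    P₁ ≠ P₂ ∧ P₁.degree = 1 ∧ P₂.degree = 1 ∧
    (∀ P : PrimeDivisor F (RatFunc F), P ≠ P₁ → P ≠ P₂ → P.IsUnramifiedIn K) ∧
    P₂.IsTamelyRamifiedIn K

/-- `G` is `L^gt_1`-realizable over the finite field `F`. -/
def IsLgt1Realizable (F : Type u) [Field F] [Finite F] (G : Type*) [Group G] : Prop :=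
  ∃ (K : Type u) (_ : Field K) (_ : Algebra F K) (_ : Algebra (RatFunc F) K)
    (_ : IsScalarTower F (RatFunc F) K), IsLgt1Realization F G K

/-- The polynomial `X^p (X - 1) - T (X - 4)^(p-2) (X - 4/3)^2` in `F[T][X]`: the outer variable
is `X`, and `T` is the variable of the coefficient ring `F[T]`. -/
noncomputable def realizingPoly (F : Type*) [Field F] (p : ℕ) : F[X][X] :=
  X ^ p * (X - 1) - C (X : F[X]) * (X - C (C 4)) ^ (p - 2) * (X - C (C (4 / 3))) ^ 2

/-- The polynomial `X^4 + X + T` in `F[T][X]`. -/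
noncomputable def realizingPolyThree (F : Type*) [Field F] : F[X][X] :=
  X ^ 4 + X + C (X : F[X])

/-! The roots of `f` form the fibre over `T` of the cover `X ↦ X^p (X-1) / ((X-4)^(p-2) (X-4/3)^2)`.
The points `4` and `4/3` are such that every root `a` satisfies `f'(a) (a-4) (a-4/3) = a^(p+2)`
(`eval_derivative_fiberPoly`). Hence `0` is the only critical point off the poles, and multiplying
over all roots gives the discriminant.

Ramification is read off from the values of the roots at a place of the splitting field and from the
inertia group there, whose order is the ramification index and which acts trivially on the residue
field (`PrimeDivisor.exists_inertia`). Where `T` is a unit, distinct roots are incongruent, so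
inertia is trivial. Over `T = 0` some root has `v(T) = v(a)^p`, so `p` divides the order of the
Galois group. Over `T = ∞` there are one pole, two roots near `4/3` with `v(a-4/3)^2 = v(1/T)`, and
all other roots are near `4`. A nontrivial inertial involution fixes the pole and the roots near
`4`, so it is a transposition. An inertial element of order `p` would be a `p`-cycle on `p + 1`
roots, yet it would fix the pole and the roots near `4/3`; so `∞` is tame. As no root is rational,
the group is `S_{p+1}` by `Subgroup.eq_top_of_prime_dvd_of_isSwap_mem`.

For `p = 3` the quartic equation reads `T = -a (a+1)^3`, with derivative `(a+1)^3`. Over `0` this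
gives ramification divisible by `3`. Over `∞` all roots have `v(a)^4 = v(T)` and inertia acts freely
on them; it has order divisible by `4` and contains a 4-cycle. Hence the group is `S_4`.

The Galois group computation is valid over every finite field of the given characteristic. So the
degree of the splitting field does not drop over a constant extension inside it, and the extension
is geometric (`isGeometricExtension_of_finrank_eq`). -/

/-! ### Valuation rings above a discrete valuation ring, and their inertia groups -/

open IsLocalRing in
/-- A valuation ring of the fraction field containing a Dedekind domain is the localization at the
prime it lies over. -/
theorem ValuationSubring.isLocalization_of_isDedekindDomain {B K : Type*} [CommRing B]
    [IsDedekindDomain B] [Field K] [Algebra B K] [IsFractionRing B K] (V : ValuationSubring K)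
    [Algebra B V] [IsScalarTower B V K] :
    IsLocalization.AtPrime V ((maximalIdeal V).under B) := by
  set q := (maximalIdeal V).under B
  have hcoe (b : B) : ((algebraMap B V b : V) : K) = algebraMap B K b :=
    (IsScalarTower.algebraMap_apply B V K b).symm
  have hunit (b : B) (hb : b ∉ q) : IsUnit (algebraMap B V b) := by
    by_contra h
    exact hb h
  have hinj : Function.Injective (algebraMap B V) := fun a b h ↦ by
    apply IsFractionRing.injective B K
    rw [← hcoe, ← hcoe, h]
  -- the localization at `q` is a valuation ring of `K`
  have hval (x : K) (hx : x ≠ 0) : ∃ a b : B, (b ∉ q ∧ x * algebraMap B K b = algebraMap B K a) ∨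
      (b ∉ q ∧ x⁻¹ * algebraMap B K b = algebraMap B K a) := by
    let Bq := Localization.AtPrime q
    by_cases hq : q = ⊥
    · obtain ⟨a, b, hb, rfl⟩ := IsFractionRing.div_surjective (A := B) x
      have hb0 : b ≠ 0 := nonZeroDivisors.ne_zero hb
      refine ⟨a, b, Or.inl ⟨by simpa [hq] using hb0, ?_⟩⟩
      rw [div_mul_cancel₀ _ (by simpa using hb0)]
    have hu (b : q.primeCompl) : IsUnit (algebraMap B K b) := by
      rw [← hcoe]
      exact (hunit b b.2).map (algebraMap V K)
    let : Algebra Bq K := (IsLocalization.lift hu).toAlgebra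
    have : IsScalarTower B Bq K := .of_algebraMap_eq fun b ↦ (IsLocalization.lift_eq hu b).symm
    have : IsDiscreteValuationRing Bq :=
      IsLocalization.AtPrime.isDiscreteValuationRing_of_dedekind_domain B hq Bq
    have : IsFractionRing Bq K := IsFractionRing.isFractionRing_of_isDomain_of_isLocalization
      q.primeCompl Bq K
    rcases ValuationRing.isInteger_or_isInteger Bq x with ⟨y, hy⟩ | ⟨y, hy⟩
    all_goals
      obtain ⟨⟨a, b⟩, hab⟩ := IsLocalization.surj q.primeCompl y
      have h := congrArg (algebraMap Bq K) hab
      rw [map_mul, hy, ← IsScalarTower.algebraMap_apply, ← IsScalarTower.algebraMap_apply] at h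
    · exact ⟨a, b, Or.inl ⟨b.2, h⟩⟩
    · exact ⟨a, b, Or.inr ⟨b.2, h⟩⟩
  refine ⟨?_, ?_, ?_⟩
  · exact fun b ↦ hunit b b.2
  · intro z
    by_cases hz : z = 0
    · exact ⟨⟨0, 1⟩, by simp [hz]⟩
    obtain ⟨a, b, ⟨hb, h⟩ | ⟨hb, h⟩⟩ := hval z (by simpa using hz)
    · exact ⟨⟨a, ⟨b, hb⟩⟩, Subtype.ext (by push_cast; rw [hcoe, hcoe, h])⟩
    · have hz' : (z : K) ≠ 0 := by simpa using hz
      have hzb : z * algebraMap B V a = algebraMap B V b := Subtype.ext <| by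
        push_cast
        rw [hcoe, hcoe, ← h, mul_inv_cancel_left₀ hz']
      -- Here `z = b / a`. If `a` were in `q`, then `b = z a` would be a non-unit of `V`, although
      -- `b ∉ q`.
      refine ⟨⟨b, ⟨a, fun ha ↦ hb ?_⟩⟩, hzb⟩
      change algebraMap B V b ∈ maximalIdeal V
      rw [← hzb]
      exact Ideal.mul_mem_left _ _ ha
  · intro x y h
    exact ⟨1, by rw [hinj h]⟩

open IsLocalRing in
/-- The inertia group of a valuation ring over a discrete valuation ring: its order is the
ramification index and it acts trivially on the residue field. -/
theorem ValuationSubring.exists_inertia {W k K : Type*} [CommRing W] [IsDomain W]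
    [IsDiscreteValuationRing W] [Field k] [Field K] [Algebra W k] [IsFractionRing W k]
    [Algebra k K] [Algebra W K] [IsScalarTower W k K] [FiniteDimensional k K] [IsGalois k K]
    (V : ValuationSubring K) [Algebra W V] [IsScalarTower W V K]
    [(maximalIdeal V).LiesOver (maximalIdeal W)] [PerfectField (maximalIdeal W).ResidueField] :
    IsDiscreteValuationRing V ∧ ∃ I : Subgroup (K ≃ₐ[k] K),
      Nat.card I = (maximalIdeal V).ramificationIdx W ∧
      ∀ σ ∈ I, ∀ x ∈ V, V.valuation (σ x - x) < 1 := by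
  -- `V` is integrally closed and contains `W`, so it contains `B` and is a localization `B_q`.
  -- Ramification and inertia are thus computed at the prime `q` of a Dedekind domain on which the
  -- Galois group acts.
  let B := integralClosure W K
  have hBV (b : B) : (b : K) ∈ V := by
    have h1 : IsIntegral V (b : K) := b.2.tower_top
    obtain ⟨y, hy⟩ := IsIntegrallyClosed.algebraMap_eq_of_integral h1
    exact hy ▸ y.2
  let : Algebra B V := (B.val.toRingHom.codRestrict V.toSubring hBV).toAlgebra
  have : IsScalarTower B V K := .of_algebraMap_eq fun _ ↦ rfl
  have : IsScalarTower W B V := .of_algebraMap_eq fun x ↦ Subtype.ext <|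
    (IsScalarTower.algebraMap_apply W V K x).symm
  have : IsFractionRing B K := integralClosure.isFractionRing_of_finite_extension k K
  have : IsDedekindDomain B := integralClosure.isDedekindDomain W k K
  have : Module.Finite W B := IsIntegralClosure.finite W k K B
  have hWK : Function.Injective (algebraMap W K) := by
    rw [IsScalarTower.algebraMap_eq W k K]
    exact (algebraMap k K).injective.comp (IsFractionRing.injective W k)
  have : FaithfulSMul W B := by
    rw [faithfulSMul_iff_algebraMap_injective]
    refine .of_comp (f := algebraMap B K) ?_
    rwa [← RingHom.coe_comp, ← IsScalarTower.algebraMap_eq]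
  have : Module.IsTorsionFree W B := inferInstance
  have hloc := V.isLocalization_of_isDedekindDomain (B := B)
  set q := (maximalIdeal V).under B with hq
  have : (maximalIdeal V).LiesOver q := ⟨hq⟩
  have : q.LiesOver (maximalIdeal W) := ⟨by
    rw [hq, Ideal.under_under]; exact Ideal.over_def (maximalIdeal V) (maximalIdeal W)⟩
  have hq0 : q ≠ ⊥ := Ideal.ne_bot_of_liesOver_of_ne_bot (IsDiscreteValuationRing.not_a_field W) q
  let : MulSemiringAction (K ≃ₐ[k] K) B := IsIntegralClosure.MulSemiringAction W k K B
  have : IsGaloisGroup (K ≃ₐ[k] K) W B := IsGaloisGroup.of_isFractionRing _ _ _ k K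
  have hsmul (σ : K ≃ₐ[k] K) (b : B) : ((σ • b : B) : K) = σ b :=
    algebraMap_galRestrict_apply W σ b
  refine ⟨IsLocalization.AtPrime.isDiscreteValuationRing_of_dedekind_domain B hq0 V,
    q.toAddSubgroup.inertia (K ≃ₐ[k] K), ?_, ?_⟩
  · have := Ideal.card_inertia_eq_ramificationIdxIn (G := K ≃ₐ[k] K) (maximalIdeal W) q
    refine this.trans ?_
    rw [Ideal.ramificationIdxIn_eq_ramificationIdx (maximalIdeal W) q (K ≃ₐ[k] K)]
    -- A localization is flat and unramified, so passing from `B` to `V` does not change the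
    -- ramification index.
    have : Module.Flat B V := IsLocalization.flat V q.primeCompl
    have : Algebra.FormallyUnramified B V := .of_isLocalization q.primeCompl
    have : Algebra.EssFiniteType B V := .of_isLocalization V q.primeCompl
    rw [Ideal.ramificationIdx_tower (R := W) q (maximalIdeal V),
      Ideal.ramificationIdx_eq_one (maximalIdeal V) B, mul_one]
  · intro σ hσ x hx
    have hlt (b : B) (hb : b ∈ q) : V.valuation (b : K) < 1 :=
      (V.valuation_lt_one_iff (algebraMap B V b)).mp hb
    have hσ' (b : B) : V.valuation (σ (b : K) - b) < 1 := by
      have := hlt _ (hσ b)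
      rwa [AddSubgroupClass.coe_sub, hsmul] at this
    have heq (b : B) (hb : b ∉ q) : V.valuation (b : K) = 1 := by
      refine le_antisymm ((V.valuation_le_one_iff _).mpr (hBV b)) (not_lt.mp fun h ↦ hb ?_)
      exact (V.valuation_lt_one_iff (algebraMap B V b)).mpr h
    obtain ⟨⟨a, b, hb⟩, hab⟩ := IsLocalization.surj q.primeCompl (⟨x, hx⟩ : V)
    replace hab : x * (b : K) = a := congrArg Subtype.val hab
    have hb1 := heq b hb
    have hx1 : V.valuation x ≤ 1 := (V.valuation_le_one_iff _).mpr hx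
    have hσb : V.valuation (σ (b : K)) = 1 := by
      have : σ (b : K) = b + (σ (b : K) - b) := by ring
      rw [this, Valuation.map_add_eq_of_lt_left _ (by rw [hb1]; exact hσ' b), hb1]
    -- With `x = a / b` and `b` a unit, triviality modulo `q` on `B` passes to fractions.
    have key : (σ x - x) * σ b = (σ (a : K) - a) - x * (σ (b : K) - b) := by
      rw [← hab, map_mul]; ring
    have := congrArg V.valuation key
    rw [map_mul, hσb, mul_one] at this
    rw [this]
    refine lt_of_le_of_lt (Valuation.map_sub _ _ _) (max_lt (hσ' a) ?_)
    rw [map_mul]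
    exact lt_of_le_of_lt (mul_le_of_le_one_left' hx1) (hσ' b)

open IsLocalRing

/-! ### Valuation rings of `E(X)` that contain `E[X]` -/

section FractionField

variable {E k : Type*} [Field E] [Field k] [Algebra E k] [Algebra E[X] k] [IsScalarTower E E[X] k]

theorem ValuationSubring.algebraMap_polynomial_mem (W : ValuationSubring k)
    (hE : ∀ c : E, algebraMap E k c ∈ W) (hX : algebraMap E[X] k X ∈ W) (f : E[X]) :
    algebraMap E[X] k f ∈ W := by
  induction f using Polynomial.induction_on' with
  | add f g hf hg => rw [map_add]; exact W.add_mem _ _ hf hg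
  | monomial n a =>
    rw [← C_mul_X_pow_eq_monomial, map_mul, map_pow, ← algebraMap_eq,
      ← IsScalarTower.algebraMap_apply]
    exact W.mul_mem _ _ (hE a) (pow_mem hX n)

theorem ValuationSubring.valuation_algebraMap_eq_one {E k : Type*} [Field E] [Field k]
    [Algebra E k] (W : ValuationSubring k) (hE : ∀ c : E, algebraMap E k c ∈ W) {c : E}
    (hc : c ≠ 0) : W.valuation (algebraMap E k c) = 1 := by
  refine le_antisymm ((W.valuation_le_one_iff _).mpr (hE c)) ?_
  have := (W.valuation_le_one_iff _).mpr (hE c⁻¹)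
  rw [map_inv₀, map_inv₀] at this
  have h0 : 0 < W.valuation (algebraMap E k c) := by simp [zero_lt_iff, hc]
  exact (inv_le_one₀ h0).mp this

theorem ValuationSubring.ne_top_of_valuation_lt_one {k : Type*} [Field k]
    (W : ValuationSubring k) {x : k} (h0 : x ≠ 0) (hx : W.valuation x < 1) : W ≠ ⊤ := by
  rintro rfl
  have h1 := (⊤ : ValuationSubring k).valuation_le_one ⟨x⁻¹, ValuationSubring.mem_top _⟩
  rw [map_inv₀] at h1
  exact not_lt.mpr h1 ((one_lt_inv₀ (by simpa [zero_lt_iff] using h0)).mpr hx)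

section Values

variable (W : ValuationSubring k) (hE : ∀ c : E, algebraMap E k c ∈ W)
  (hX : W.valuation (algebraMap E[X] k X) < 1)

include hE hX in
theorem ValuationSubring.valuation_polynomial_lt_one_iff (f : E[X]) :
    W.valuation (algebraMap E[X] k f) < 1 ↔ f.coeff 0 = 0 := by
  have hmem := W.algebraMap_polynomial_mem hE ((W.valuation_le_one_iff _).mp hX.le)
  have h1 : W.valuation (algebraMap E[X] k (X * f.divX)) < 1 := by
    rw [map_mul, map_mul]
    exact mul_lt_one_of_lt_of_le hX ((W.valuation_le_one_iff _).mpr (hmem _))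
  constructor
  · intro h
    by_contra h0
    have h2 := W.valuation_algebraMap_eq_one hE h0
    have h3 : algebraMap E k (f.coeff 0) =
        algebraMap E[X] k f - algebraMap E[X] k (X * f.divX) := by
      rw [← map_sub, IsScalarTower.algebraMap_apply E E[X] k, algebraMap_eq]
      congr 1
      rw [eq_sub_iff_add_eq', X_mul_divX_add]
    rw [h3] at h2
    exact (lt_of_le_of_lt (Valuation.map_sub _ _ _) (max_lt h h1)).ne h2
  · intro h
    rwa [← X_mul_divX_add f, h, C_0, add_zero]

include hE hX in
theorem ValuationSubring.valuation_polynomial_eq_one_iff (f : E[X]) :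
    W.valuation (algebraMap E[X] k f) = 1 ↔ f.coeff 0 ≠ 0 := by
  have hmem := W.algebraMap_polynomial_mem hE ((W.valuation_le_one_iff _).mp hX.le)
  rw [Ne, ← W.valuation_polynomial_lt_one_iff hE hX]
  exact ⟨fun h ↦ h.not_lt, fun h ↦ le_antisymm ((W.valuation_le_one_iff _).mpr (hmem f))
    (not_lt.mp h)⟩

end Values

variable [IsFractionRing E[X] k]

/-- Let a valuation ring `W` of the field of fractions of `E[X]` contain `E[X]`. Then `W` is the
localization of `E[X]` at the prime ideal of all polynomials of positive value. -/
theorem ValuationSubring.exists_div_of_polynomial (W : ValuationSubring k)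
    (hE : ∀ c : E, algebraMap E k c ∈ W) (hX : algebraMap E[X] k X ∈ W) (hW : W ≠ ⊤) :
    IsDiscreteValuationRing W ∧
    (∀ x ∈ W, ∃ f g : E[X], x = algebraMap E[X] k f / algebraMap E[X] k g ∧
      W.valuation (algebraMap E[X] k g) = 1) ∧
    (Finite E → Finite (ResidueField W)) := by
  have hmem := W.algebraMap_polynomial_mem hE hX
  let : Algebra E[X] W := ((algebraMap E[X] k).codRestrict W.toSubring hmem).toAlgebra
  have : IsScalarTower E[X] W k := .of_algebraMap_eq fun _ ↦ rfl
  have hcoe (f : E[X]) : ((algebraMap E[X] W f : W) : k) = algebraMap E[X] k f := rfl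
  have hloc := W.isLocalization_of_isDedekindDomain (B := E[X])
  set q := (maximalIdeal W).under E[X] with hq
  have hq1 (f : E[X]) : f ∈ q ↔ W.valuation (algebraMap E[X] k f) < 1 :=
    W.valuation_lt_one_iff (algebraMap E[X] W f)
  have hq2 (f : E[X]) (hf : f ∉ q) : W.valuation (algebraMap E[X] k f) = 1 :=
    (W.valuation_lt_one_or_eq_one (algebraMap E[X] W f)).resolve_left fun h ↦ hf ((hq1 f).mpr h)
  have hdiv : ∀ x ∈ W, ∃ f g : E[X], x = algebraMap E[X] k f / algebraMap E[X] k g ∧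
      W.valuation (algebraMap E[X] k g) = 1 := by
    intro x hx
    obtain ⟨⟨a, b, hb⟩, hab⟩ := IsLocalization.surj q.primeCompl (⟨x, hx⟩ : W)
    replace hab : x * algebraMap E[X] k b = algebraMap E[X] k a := congrArg Subtype.val hab
    have hb1 := hq2 b hb
    refine ⟨a, b, ?_, hb1⟩
    rw [← hab, mul_div_cancel_right₀]
    intro h0
    simp [h0] at hb1
  have hq0 : q ≠ ⊥ := by
    intro h0
    refine hW (_root_.eq_top_iff.mpr fun x _ ↦ ?_)
    obtain ⟨a, b, hb, rfl⟩ := IsFractionRing.div_surjective (A := E[X]) x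
    have hb1 : b ∉ q := by simpa [h0] using nonZeroDivisors.ne_zero hb
    rw [← W.valuation_le_one_iff, map_div₀, hq2 b hb1, div_one]
    exact W.valuation_le_one (algebraMap E[X] W a)
  obtain ⟨f, hf⟩ := IsPrincipalIdealRing.principal q
  rw [Ideal.submodule_span_eq] at hf
  have hf0 : f ≠ 0 := by rintro rfl; exact hq0 (by rw [hf, Ideal.span_singleton_eq_bot])
  refine ⟨IsLocalization.AtPrime.isDiscreteValuationRing_of_dedekind_domain E[X] hq0 W,
    hdiv, fun _ ↦ ?_⟩
  have : q.IsMaximal := (inferInstance : q.IsPrime).isMaximal hq0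
  -- The residue field is `E[X] / (f)`, of finite dimension over `E`.
  have : Module.Finite E (AdjoinRoot f) := (AdjoinRoot.powerBasis hf0).finite
  have : Finite (AdjoinRoot f) := Module.finite_of_finite E
  have : Finite (E[X] ⧸ q) := by rw [hf]; exact this
  exact Finite.of_equiv _ (IsLocalization.AtPrime.equivQuotMaximalIdeal q W).toEquiv

section RationalPlace

variable (W : ValuationSubring k) (hE : ∀ c : E, algebraMap E k c ∈ W)
  (hX : W.valuation (algebraMap E[X] k X) < 1)

include hE hX in
-- A fraction with unit denominator has value below `1` exactly when its numerator vanishes at `0`,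
-- so `X` is a uniformizer.
theorem ValuationSubring.exists_eq_X_mul {x : k} (hx : W.valuation x < 1) :
    ∃ y ∈ W, x = algebraMap E[X] k X * y := by
  have hmem := W.algebraMap_polynomial_mem hE ((W.valuation_le_one_iff _).mp hX.le)
  obtain ⟨-, hdiv, -⟩ := W.exists_div_of_polynomial hE ((W.valuation_le_one_iff _).mp hX.le)
    (W.ne_top_of_valuation_lt_one (by simp) hX)
  obtain ⟨a, b, rfl, hb⟩ := hdiv x ((W.valuation_le_one_iff x).mp hx.le)
  rw [map_div₀, hb, div_one, W.valuation_polynomial_lt_one_iff hE hX] at hx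
  refine ⟨algebraMap E[X] k a.divX / algebraMap E[X] k b, ?_, ?_⟩
  · rw [← W.valuation_le_one_iff, map_div₀, hb, div_one, W.valuation_le_one_iff]
    exact hmem _
  · rw [← mul_div_assoc, ← map_mul]
    congr 2
    simpa [hx] using (X_mul_divX_add a).symm

include hE hX in
theorem ValuationSubring.exists_sub_algebraMap_lt_one {x : k} (hx : x ∈ W) :
    ∃ c : E, W.valuation (x - algebraMap E k c) < 1 := by
  obtain ⟨-, hdiv, -⟩ := W.exists_div_of_polynomial hE ((W.valuation_le_one_iff _).mp hX.le)
    (W.ne_top_of_valuation_lt_one (by simp) hX)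
  obtain ⟨a, b, rfl, hb⟩ := hdiv x hx
  have hb0 := (W.valuation_polynomial_eq_one_iff hE hX b).mp hb
  have hb' : algebraMap E[X] k b ≠ 0 := fun h ↦ by simp [h] at hb
  refine ⟨a.coeff 0 / b.coeff 0, ?_⟩
  have : algebraMap E[X] k a / algebraMap E[X] k b - algebraMap E k (a.coeff 0 / b.coeff 0) =
      algebraMap E[X] k (a - C (a.coeff 0 / b.coeff 0) * b) / algebraMap E[X] k b := by
    rw [map_sub, map_mul, ← algebraMap_eq, ← IsScalarTower.algebraMap_apply, sub_div,
      mul_div_cancel_right₀ _ hb']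
  rw [this, map_div₀, hb, div_one, W.valuation_polynomial_lt_one_iff hE hX]
  simp [div_mul_cancel₀ _ hb0]

include hE hX in
-- Which polynomials may serve as denominators depends only on their constant term. By symmetry this
-- gives uniqueness of the place where `X` vanishes.
theorem ValuationSubring.le_of_valuation_X_lt_one (W' : ValuationSubring k)
    (hE' : ∀ c : E, algebraMap E k c ∈ W') (hX' : W'.valuation (algebraMap E[X] k X) < 1) :
    W ≤ W' := by
  obtain ⟨-, hdiv, -⟩ := W.exists_div_of_polynomial hE ((W.valuation_le_one_iff _).mp hX.le)
    (W.ne_top_of_valuation_lt_one (by simp) hX)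
  intro x hx
  obtain ⟨a, b, rfl, hb⟩ := hdiv x hx
  rw [W.valuation_polynomial_eq_one_iff hE hX, ← W'.valuation_polynomial_eq_one_iff hE' hX'] at hb
  rw [← W'.valuation_le_one_iff, map_div₀, hb, div_one, W'.valuation_le_one_iff]
  exact W'.algebraMap_polynomial_mem hE' ((W'.valuation_le_one_iff _).mp hX'.le) a

end RationalPlace

variable (E k) in
theorem ValuationSubring.exists_valuation_X_lt_one :
    ∃ W : ValuationSubring k, (∀ c : E, algebraMap E k c ∈ W) ∧
      W.valuation (algebraMap E[X] k X) < 1 := by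
  let v : IsDedekindDomain.HeightOneSpectrum E[X] :=
    ⟨Ideal.span {X}, (Ideal.span_singleton_prime X_ne_zero).mpr prime_X, by simp⟩
  refine ⟨(v.valuation k).valuationSubring, fun c ↦ ?_, ?_⟩
  · rw [Valuation.mem_valuationSubring_iff, IsScalarTower.algebraMap_apply E E[X] k]
    exact v.valuation_le_one _
  · rw [← (Valuation.isEquiv_valuation_valuationSubring (v.valuation k)).lt_one_iff_lt_one,
      v.valuation_lt_one_iff_mem]
    exact Ideal.mem_span_singleton_self X

end FractionField

/-! ### The place at infinity, reached through the coordinate `1 / X` -/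

theorem RatFunc.exists_algEquiv_X_inv (E : Type*) [Field E] :
    ∃ φ : RatFunc E ≃ₐ[E] RatFunc E, φ RatFunc.X = RatFunc.X⁻¹ := by
  have ht : Transcendental E (RatFunc.X⁻¹ : RatFunc E) := by
    intro h
    have := h.inv
    rw [inv_inv] at this
    exact RatFunc.transcendental_X this
  have htop : IntermediateField.adjoin E {(RatFunc.X⁻¹ : RatFunc E)} = ⊤ := by
    rw [_root_.eq_top_iff, ← RatFunc.adjoin_X, IntermediateField.adjoin_simple_le_iff]
    simpa using inv_mem (IntermediateField.mem_adjoin_simple_self E (RatFunc.X⁻¹ : RatFunc E))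
  refine ⟨(RatFunc.algEquivOfTranscendental _ ht).trans
    ((IntermediateField.equivOfEq htop).trans IntermediateField.topEquiv), ?_⟩
  simp

/-- The structure of `E[X]`-algebra on `E(X)` that sends `X` to `1 / X`. -/
theorem RatFunc.exists_algebra_X_inv (E : Type*) [Field E] :
    ∃ a : Algebra E[X] (RatFunc E),
      @IsScalarTower E E[X] (RatFunc E) Algebra.toSMul a.toSMul Algebra.toSMul ∧ @IsFractionRing E[X] _ (RatFunc E) _ a ∧
      @algebraMap E[X] (RatFunc E) _ _ a Polynomial.X = RatFunc.X⁻¹ := by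
  obtain ⟨φ, hφ⟩ := RatFunc.exists_algEquiv_X_inv E
  have h1 (c : E) : algebraMap E (RatFunc E) c =
      φ (algebraMap E[X] (RatFunc E) (algebraMap E E[X] c)) := by
    rw [← IsScalarTower.algebraMap_apply, AlgEquiv.commutes]
  have h2 := (IsLocalization.isLocalization_iff_of_ringEquiv (nonZeroDivisors E[X])
    φ.toRingEquiv).mp inferInstance
  have h3 : φ (algebraMap E[X] (RatFunc E) Polynomial.X) = RatFunc.X⁻¹ := by
    rw [RatFunc.algebraMap_X, hφ]
  let a := (φ.toRingEquiv.toRingHom.comp (algebraMap E[X] (RatFunc E))).toAlgebra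
  exact ⟨a, @IsScalarTower.of_algebraMap_eq E E[X] (RatFunc E) _ _ _ _ a _ h1, h2, h3⟩

open IsLocalRing

/-- The ramification index of a valuation ring is divisible by `n` if the `n`-th power of an
element has the value of a uniformizer of the base. -/
theorem ValuationSubring.dvd_ramificationIdx {W K : Type*} [CommRing W] [IsDomain W]
    [IsDiscreteValuationRing W] [Field K] (V : ValuationSubring K) [IsDiscreteValuationRing V]
    [Algebra W V] [FaithfulSMul W V] [(maximalIdeal V).LiesOver (maximalIdeal W)]
    {θ : W} (hθ : maximalIdeal W = Ideal.span {θ}) {y : K} {n : ℕ}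
    (hy : V.valuation (algebraMap W V θ : V) = V.valuation y ^ n) :
    n ∣ (maximalIdeal V).ramificationIdx W := by
  obtain ⟨ϖ, hϖ⟩ := IsDiscreteValuationRing.exists_irreducible V
  have hθm : algebraMap W V θ ∈ maximalIdeal V := by
    have : θ ∈ (maximalIdeal V).under W := by
      rw [← Ideal.over_def (maximalIdeal V) (maximalIdeal W), hθ]
      exact Ideal.mem_span_singleton_self θ
    exact this
  have hθ0 : algebraMap W V θ ≠ 0 := by
    rw [Ne, FaithfulSMul.algebraMap_eq_zero_iff]
    rintro rfl
    exact IsDiscreteValuationRing.not_a_field W (by simpa using hθ)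
  have hn : n ≠ 0 := by
    rintro rfl
    rw [pow_zero] at hy
    exact ((V.valuation_lt_one_iff _).mp hθm).ne hy
  have hy1 : V.valuation y ≤ 1 := by
    rw [← pow_le_one_iff hn, ← hy]
    exact V.valuation_le_one _
  lift y to V using (V.valuation_le_one_iff y).mp hy1
  have hy0 : y ≠ 0 := by
    rintro rfl
    rw [ZeroMemClass.coe_zero, map_zero, zero_pow hn, map_eq_zero] at hy
    exact hθ0 (Subtype.ext hy)
  obtain ⟨j, hj⟩ := IsDiscreteValuationRing.associated_pow_irreducible hy0 hϖ
  have hass : Associated (algebraMap W V θ) (y ^ n) := by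
    rw [← map_pow, V.valuation_eq_iff] at hy
    obtain ⟨u, hu⟩ := hy
    exact Associated.symm ⟨u, Subtype.ext (by push_cast; rw [mul_comm]; exact hu)⟩
  -- Here `y` is a unit times `ϖ ^ j`, so the ramification index is exactly `j * n`.
  have hspan : (maximalIdeal W).map (algebraMap W V) = maximalIdeal V ^ (j * n) := by
    rw [hθ, Ideal.map_span, Set.image_singleton, hϖ.maximalIdeal_eq, Ideal.span_singleton_pow,
      Ideal.span_singleton_eq_span_singleton, pow_mul]
    exact hass.trans (hj.pow_pow)
  have hlt : ¬ (maximalIdeal W).map (algebraMap W V) ≤ maximalIdeal V ^ (j * n + 1) := by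
    rw [hspan, hϖ.maximalIdeal_eq, Ideal.span_singleton_pow, Ideal.span_singleton_pow,
      Ideal.span_singleton_le_span_singleton, pow_dvd_pow_iff hϖ.ne_zero hϖ.not_isUnit]
    omega
  rw [← Ideal.ramificationIdx'_eq_ramificationIdx' (maximalIdeal W) (maximalIdeal V)
    (by rw [hspan]; exact pow_ne_zero _ (IsDiscreteValuationRing.not_a_field V)),
    Ideal.ramificationIdx'_spec hspan.le hlt]
  exact dvd_mul_left n j

/-! ### Prime divisors of `E(T)` and of its extensions -/

namespace PrimeDivisor

section RatFunc

variable {E : Type*} [Field E] (P : PrimeDivisor E (RatFunc E))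

/-- Either `X` or `1 / X` lies in the valuation ring, so up to this change of coordinate the ring
contains `E[X]`. -/
theorem isDiscreteValuationRing_and_finite_residueField :
    IsDiscreteValuationRing P.ring ∧ (Finite E → Finite (ResidueField P.ring)) := by
  rcases P.ring.mem_or_inv_mem RatFunc.X with h | h
  · have := P.ring.exists_div_of_polynomial P.algebraMap_mem (by rwa [RatFunc.algebraMap_X])
      P.ne_top
    exact ⟨this.1, this.2.2⟩
  · obtain ⟨a, h1, h2, h3⟩ := RatFunc.exists_algebra_X_inv E
    have := @ValuationSubring.exists_div_of_polynomial E (RatFunc E) _ _ _ a h1 h2 P.ring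
      P.algebraMap_mem (by rwa [h3]) P.ne_top
    exact ⟨this.1, this.2.2⟩

theorem exists_eq_mul_of_valuation_lt_one {θ : RatFunc E}
    (hθ : θ = RatFunc.X ∨ θ = RatFunc.X⁻¹) (hP : P.ring.valuation θ < 1) {x : RatFunc E}
    (hx : P.ring.valuation x < 1) : ∃ y ∈ P.ring, x = θ * y := by
  rcases hθ with rfl | rfl
  · rw [← RatFunc.algebraMap_X] at hP ⊢
    exact P.ring.exists_eq_X_mul P.algebraMap_mem hP hx
  · obtain ⟨a, h1, h2, h3⟩ := RatFunc.exists_algebra_X_inv E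
    rw [← h3] at hP ⊢
    exact @ValuationSubring.exists_eq_X_mul E (RatFunc E) _ _ _ a h1 h2 P.ring P.algebraMap_mem hP
      _ hx

theorem degree_eq_one_of_valuation_lt_one {θ : RatFunc E}
    (hθ : θ = RatFunc.X ∨ θ = RatFunc.X⁻¹) (hP : P.ring.valuation θ < 1) : P.degree = 1 := by
  have key (x : P.ring) : ∃ c : E, x - algebraMap E P.ring c ∈ maximalIdeal P.ring := by
    have : ∃ c : E, P.ring.valuation ((x : RatFunc E) - algebraMap E (RatFunc E) c) < 1 := by
      rcases hθ with rfl | rfl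
      · rw [← RatFunc.algebraMap_X] at hP
        exact P.ring.exists_sub_algebraMap_lt_one P.algebraMap_mem hP x.2
      · obtain ⟨a, h1, h2, h3⟩ := RatFunc.exists_algebra_X_inv E
        rw [← h3] at hP
        exact @ValuationSubring.exists_sub_algebraMap_lt_one E (RatFunc E) _ _ _ a h1 h2 P.ring
          P.algebraMap_mem hP _ x.2
    obtain ⟨c, hc⟩ := this
    exact ⟨c, (P.ring.valuation_lt_one_iff _).mpr hc⟩
  rw [degree, finrank_eq_one_iff']
  refine ⟨1, one_ne_zero, fun w ↦ ?_⟩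
  obtain ⟨x, rfl⟩ := residue_surjective w
  obtain ⟨c, hc⟩ := key x
  refine ⟨c, ?_⟩
  rw [← Algebra.algebraMap_eq_smul_one, IsScalarTower.algebraMap_apply E P.ring]
  exact (Ideal.Quotient.eq.mpr hc).symm

theorem ext_of_ring_eq {F K : Type*} [Field F] [Field K] [Algebra F K] {P P' : PrimeDivisor F K}
    (h : P.ring = P'.ring) : P = P' := by
  cases P; cases P'; congr

theorem eq_of_valuation_lt_one {P P' : PrimeDivisor E (RatFunc E)} {θ : RatFunc E}
    (hθ : θ = RatFunc.X ∨ θ = RatFunc.X⁻¹) (hP : P.ring.valuation θ < 1)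
    (hP' : P'.ring.valuation θ < 1) : P = P' := by
  apply ext_of_ring_eq
  rcases hθ with rfl | rfl
  · rw [← RatFunc.algebraMap_X] at hP hP'
    exact le_antisymm
      (P.ring.le_of_valuation_X_lt_one P.algebraMap_mem hP P'.ring P'.algebraMap_mem hP')
      (P'.ring.le_of_valuation_X_lt_one P'.algebraMap_mem hP' P.ring P.algebraMap_mem hP)
  · obtain ⟨a, h1, h2, h3⟩ := RatFunc.exists_algebra_X_inv E
    rw [← h3] at hP hP'
    exact le_antisymm
      (@ValuationSubring.le_of_valuation_X_lt_one E (RatFunc E) _ _ _ a h1 h2 P.ring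
        P.algebraMap_mem hP P'.ring P'.algebraMap_mem hP')
      (@ValuationSubring.le_of_valuation_X_lt_one E (RatFunc E) _ _ _ a h1 h2 P'.ring
        P'.algebraMap_mem hP' P.ring P.algebraMap_mem hP)

variable (E) in
theorem exists_valuation_lt_one {θ : RatFunc E} (hθ : θ = RatFunc.X ∨ θ = RatFunc.X⁻¹) :
    ∃ P : PrimeDivisor E (RatFunc E), P.ring.valuation θ < 1 := by
  rcases hθ with rfl | rfl
  · obtain ⟨W, hE, hW⟩ := ValuationSubring.exists_valuation_X_lt_one E (RatFunc E)
    rw [RatFunc.algebraMap_X] at hW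
    exact ⟨⟨W, hE, W.ne_top_of_valuation_lt_one RatFunc.X_ne_zero hW⟩, hW⟩
  · obtain ⟨a, h1, h2, h3⟩ := RatFunc.exists_algebra_X_inv E
    obtain ⟨W, hE, hW⟩ := @ValuationSubring.exists_valuation_X_lt_one E (RatFunc E) _ _ _ a h1 h2
    rw [h3] at hW
    exact ⟨⟨W, hE, W.ne_top_of_valuation_lt_one (inv_ne_zero RatFunc.X_ne_zero) hW⟩, hW⟩

end RatFunc

section Extension

variable {E k K : Type*} [Field E] [Field k] [Field K] [Algebra E k] [Algebra E K] [Algebra k K]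
  [IsScalarTower E k K]

variable (k) in
/-- The prime divisor below a prime divisor of an algebraic extension. -/
def below [Algebra.IsAlgebraic k K] (Q : PrimeDivisor E K) : PrimeDivisor E k where
  ring := Q.ring.comap (algebraMap k K)
  algebraMap_mem c := by
    rw [ValuationSubring.mem_comap, ← IsScalarTower.algebraMap_apply]
    exact Q.algebraMap_mem c
  ne_top h := by
    -- A valuation ring containing `k` is integrally closed, hence contains everything algebraic
    -- over `k`.
    refine Q.ne_top (eq_top_iff.mpr fun x _ ↦ ?_)
    have hk (c : k) : algebraMap k K c ∈ Q.ring := by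
      rw [← ValuationSubring.mem_comap, h]; exact ValuationSubring.mem_top c
    let : Algebra k Q.ring := ((algebraMap k K).codRestrict Q.ring.toSubring hk).toAlgebra
    have : IsScalarTower k Q.ring K := .of_algebraMap_eq fun _ ↦ rfl
    have h1 : IsIntegral Q.ring x := (Algebra.IsIntegral.isIntegral (R := k) x).tower_top
    obtain ⟨y, hy⟩ := IsIntegrallyClosed.algebraMap_eq_of_integral h1
    exact hy ▸ y.2

theorem below_valuation_lt_one_iff [Algebra.IsAlgebraic k K] (Q : PrimeDivisor E K) (x : k) :
    (Q.below k).ring.valuation x < 1 ↔ Q.ring.valuation (algebraMap k K x) < 1 := by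
  rw [← ValuationSubring.mem_nonunits_iff, ← ValuationSubring.mem_nonunits_iff,
    ValuationSubring.mem_nonunits_iff_or, ValuationSubring.mem_nonunits_iff_or, map_eq_zero,
    ← map_inv₀]
  rfl

/-- Some valuation ring of `K` dominates `P.ring`. Domination forces the contraction to be no
larger: if `x` is in it but not in `P.ring`, then `x⁻¹` becomes a unit above, hence is one already
below. -/
theorem exists_liesOver (P : PrimeDivisor E k) : ∃ Q : PrimeDivisor E K, Q.LiesOver P := by
  obtain ⟨A, h, hloc⟩ := exists_factor_valuationRing ((algebraMap k K).comp P.ring.subtype)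
  have hA : A.comap (algebraMap k K) = P.ring := by
    ext x
    rw [ValuationSubring.mem_comap]
    refine ⟨fun hx ↦ ?_, fun hx ↦ h ⟨x, hx⟩⟩
    by_contra hxP
    have hx0 : x ≠ 0 := by rintro rfl; exact hxP (zero_mem _)
    have hxi := (P.ring.mem_or_inv_mem x).resolve_left hxP
    refine hxP ?_
    have hu : IsUnit (⟨x⁻¹, hxi⟩ : P.ring) := by
      apply hloc.map_nonunit
      refine .of_mul_eq_one ⟨algebraMap k K x, hx⟩ (Subtype.ext ?_)
      change algebraMap k K x⁻¹ * algebraMap k K x = 1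
      rw [← map_mul, inv_mul_cancel₀ hx0, map_one]
    obtain ⟨z, hz⟩ := hu.exists_right_inv
    have : x = z := by
      have := congrArg Subtype.val hz
      replace this : x⁻¹ * (z : k) = 1 := this
      rwa [inv_mul_eq_one₀ hx0] at this
    exact this ▸ z.2
  refine ⟨⟨A, fun c ↦ ?_, ?_⟩, hA⟩
  · rw [IsScalarTower.algebraMap_apply E k K]
    exact h ⟨_, P.algebraMap_mem c⟩
  · rintro rfl
    exact P.ne_top (hA ▸ rfl)

end Extension

/-- Finiteness of `E` makes the residue fields finite, hence perfect, as needed for the inertia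
group to have order equal to the ramification index. The last clause exploits that `X` and `1 / X`
are uniformizers at the places where they vanish. -/
theorem exists_inertia {E K : Type*} [Field E] [Finite E] [Field K] [Algebra E K]
    [Algebra (RatFunc E) K] [IsScalarTower E (RatFunc E) K] [FiniteDimensional (RatFunc E) K]
    [IsGalois (RatFunc E) K] (Q : PrimeDivisor E K) :
    ∃ I : Subgroup (K ≃ₐ[RatFunc E] K), Nat.card I = Q.ramificationIdx (RatFunc E) ∧
      (∀ σ ∈ I, ∀ x, Q.ring.valuation x ≤ 1 → Q.ring.valuation (σ x - x) < 1) ∧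
      (∀ θ : RatFunc E, θ = RatFunc.X ∨ θ = RatFunc.X⁻¹ →
        Q.ring.valuation (algebraMap (RatFunc E) K θ) < 1 → ∀ (y : K) (n : ℕ),
        Q.ring.valuation (algebraMap (RatFunc E) K θ) = Q.ring.valuation y ^ n →
        n ∣ Q.ramificationIdx (RatFunc E)) := by
  let P := Q.below (RatFunc E)
  let W := Q.ring.comap (algebraMap (RatFunc E) K)
  obtain ⟨h1, h2⟩ := P.isDiscreteValuationRing_and_finite_residueField
  have : IsDiscreteValuationRing W := h1
  have : Finite (ResidueField W) := h2 inferInstance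
  let : Algebra W Q.ring := ((algebraMap (RatFunc E) K).restrict W Q.ring (fun _ h => h)).toAlgebra
  let : Algebra W K := ((algebraMap (RatFunc E) K).comp (algebraMap W (RatFunc E))).toAlgebra
  have : IsScalarTower W (RatFunc E) K := .of_algebraMap_eq fun _ ↦ rfl
  have : IsScalarTower W Q.ring K := .of_algebraMap_eq fun _ ↦ rfl
  have : PerfectField (maximalIdeal W).ResidueField := by
    have : Finite (W ⧸ maximalIdeal W) := ‹Finite (ResidueField W)›
    have : Finite (maximalIdeal W).ResidueField := Finite.of_surjective _
      (Ideal.bijective_algebraMap_quotient_residueField (maximalIdeal W)).surjective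
    infer_instance
  have hover : (maximalIdeal Q.ring).LiesOver (maximalIdeal W) := ⟨by
    ext x
    change x ∈ maximalIdeal W ↔ algebraMap W Q.ring x ∈ maximalIdeal Q.ring
    rw [W.valuation_lt_one_iff, Q.ring.valuation_lt_one_iff]
    exact Q.below_valuation_lt_one_iff x.1⟩
  have : FaithfulSMul W Q.ring := by
    rw [faithfulSMul_iff_algebraMap_injective]
    intro a b hab
    exact Subtype.ext ((algebraMap (RatFunc E) K).injective (congrArg Subtype.val hab))
  obtain ⟨hV, I, hI, hI'⟩ := Q.ring.exists_inertia (W := W) (k := RatFunc E)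
  refine ⟨I, hI, fun σ hσ x hx ↦ hI' σ hσ x ((Q.ring.valuation_le_one_iff x).mp hx), ?_⟩
  intro θ hθ hθ1 y n hy
  have hθP : P.ring.valuation θ < 1 := (Q.below_valuation_lt_one_iff θ).mpr hθ1
  have hθW : θ ∈ W := (P.ring.valuation_le_one_iff θ).mp hθP.le
  refine Q.ring.dvd_ramificationIdx (W := W) (θ := ⟨θ, hθW⟩) (le_antisymm ?_ ?_) hy
  · intro x hx
    obtain ⟨y, hy, hxy⟩ := P.exists_eq_mul_of_valuation_lt_one hθ hθP
      ((W.valuation_lt_one_iff x).mp hx)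
    exact Ideal.mem_span_singleton.mpr ⟨⟨y, hy⟩, Subtype.ext hxy⟩
  · rw [Ideal.span_singleton_le_iff_mem]
    exact (W.valuation_lt_one_iff _).mpr hθP

end PrimeDivisor

/-! ### Values of the points in a fibre of the cover -/

section Valuation

variable {K Γ : Type*} [Field K] [LinearOrderedCommGroupWithZero Γ] (v : Valuation K Γ)

theorem Valuation.map_sub_eq_one_of_lt {x a b : K} (hx : v (x - a) < 1) (hab : v (a - b) = 1) :
    v (x - b) = 1 := by
  have : x - b = (a - b) + (x - a) := by ring
  rw [this, Valuation.map_add_eq_of_lt_left _ (by rwa [hab]), hab]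

theorem Valuation.map_sub_eq_of_one_lt {x a : K} (hx : 1 < v x) (ha : v a ≤ 1) :
    v (x - a) = v x := by
  rw [sub_eq_add_neg, Valuation.map_add_eq_of_lt_left]
  rw [Valuation.map_neg]
  exact ha.trans_lt hx

theorem Valuation.map_sub_le_one {x a : K} (hx : v x ≤ 1) (ha : v a ≤ 1) : v (x - a) ≤ 1 :=
  (Valuation.map_sub v x a).trans (max_le hx ha)

theorem root_eq_of_prod_eq {K : Type*} [Field K] {p : ℕ} {t : K} {S : Finset K}
    (hS : ∀ z : K, ∏ a ∈ S, (z - a) = z ^ p * (z - 1) - t * (z - 4) ^ (p - 2) * (z - 4 / 3) ^ 2)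
    {a : K} (ha : a ∈ S) : a ^ p * (a - 1) = t * (a - 4) ^ (p - 2) * (a - 4 / 3) ^ 2 := by
  rw [← sub_eq_zero, ← hS, Finset.prod_eq_zero ha (sub_self a)]

variable {p : ℕ} (hp : 3 < p) {t : K} (h2 : v 2 = 1) (h3 : v 3 = 1)

include h2 h3 in
/-- Values of the constants `4`, `4 / 3`, and of their differences with `1`. -/
theorem Valuation.map_branch_points :
    v 4 = 1 ∧ v (4 / 3) = 1 ∧ v (4 - 1) = 1 ∧ v (4 / 3 - 1) = 1 ∧ v (4 - 4 / 3) = 1 ∧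
      v (4 / 3 - 4) = 1 ∧ v (4 / 9) = 1 := by
  have h30 : (3 : K) ≠ 0 := fun h ↦ by simp [h] at h3
  have h4 : v 4 = 1 := by rw [show (4 : K) = 2 * 2 by norm_num, map_mul, h2, mul_one]
  have h9 : v 9 = 1 := by rw [show (9 : K) = 3 * 3 by norm_num, map_mul, h3, mul_one]
  have h8 : v (4 - 4 / 3) = 1 := by
    rw [show (4 - 4 / 3 : K) = 2 * 4 / 3 by field_simp; norm_num, map_div₀, map_mul, h2, h3, h4]
    simp
  refine ⟨h4, ?_, ?_, ?_, h8, ?_, ?_⟩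
  · rw [map_div₀, h4, h3, div_one]
  · rw [show (4 - 1 : K) = 3 by norm_num, h3]
  · rw [show (4 / 3 - 1 : K) = 1 / 3 by field_simp; norm_num, map_div₀, h3, map_one, div_one]
  · rw [Valuation.map_sub_swap, h8]
  · rw [map_div₀, h4, h9, div_one]

section Infinity

variable (ht : 1 < v t)

include hp h2 h3 ht in
/-- The three kinds of roots over `T = ∞`. -/
theorem Valuation.root_trichotomy {a : K}
    (ha : a ^ p * (a - 1) = t * (a - 4) ^ (p - 2) * (a - 4 / 3) ^ 2) :
    (1 < v a ∧ v a = v t) ∨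
    (v a = 1 ∧ v (a - 4) < 1 ∧ v (a - 4 / 3) = 1 ∧ v (a - 1) = 1) ∨
    (v a = 1 ∧ v (a - 4) = 1 ∧ v (a - 4 / 3) < 1 ∧ v (a - 4 / 3) ^ 2 * v t = 1) := by
  obtain ⟨h4, hc, h41, hc1, h4c, hc4, -⟩ := v.map_branch_points h2 h3
  have hva := congrArg v ha
  simp only [map_mul, map_pow] at hva
  rcases lt_or_ge 1 (v a) with h | h
  · left
    rw [v.map_sub_eq_of_one_lt h (by rw [map_one]), v.map_sub_eq_of_one_lt h h4.le,
      v.map_sub_eq_of_one_lt h hc.le, mul_assoc, ← pow_add, show p - 2 + 2 = p by omega,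
      mul_comm (v t)] at hva
    exact ⟨h, mul_left_cancel₀ (pow_ne_zero _ (zero_lt_one.trans h).ne') hva⟩
  · right
    have h1 : v (a - 4) ≤ 1 := v.map_sub_le_one h h4.le
    have h2 : v (a - 4 / 3) ≤ 1 := v.map_sub_le_one h hc.le
    rcases h1.lt_or_eq with h1 | h1
    · left
      refine ⟨?_, h1, v.map_sub_eq_one_of_lt h1 h4c, v.map_sub_eq_one_of_lt h1 h41⟩
      simpa using v.map_sub_eq_one_of_lt (b := 0) h1 (by simpa using h4)
    · right
      have h2' : v (a - 4 / 3) < 1 := by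
        -- Away from both `4` and `4 / 3`, the right side of the equation would have value `v t > 1`
        -- while the left side is integral.
        refine h2.lt_of_ne fun h2 ↦ ?_
        rw [h1, h2, one_pow, one_pow, mul_one, mul_one] at hva
        have : v a ^ p * v (a - 1) ≤ 1 :=
          mul_le_one' (pow_le_one' h p) (v.map_sub_le_one h (by rw [map_one]))
        exact this.not_gt (hva ▸ ht)
      have ha1 : v a = 1 := by
        simpa using v.map_sub_eq_one_of_lt (b := 0) h2' (by simpa using hc)
      refine ⟨ha1, h1, h2', ?_⟩
      rw [ha1, h1, v.map_sub_eq_one_of_lt h2' hc1, one_pow, one_pow, mul_one, mul_one] at hva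
      rw [mul_comm]; exact hva.symm

variable {S : Finset K}
  (hS : ∀ z : K, ∏ a ∈ S, (z - a) = z ^ p * (z - 1) - t * (z - 4) ^ (p - 2) * (z - 4 / 3) ^ 2)

include hp h2 h3 ht hS in
open Classical in
-- Evaluate the polynomial at `0`: its value is `v t`, a pole contributes a factor `v t`, and every
-- other root contributes `1`.
theorem Valuation.card_filter_pole : (S.filter fun a ↦ 1 < v a).card = 1 := by
  obtain ⟨h4, hc, -⟩ := v.map_branch_points h2 h3
  have h := congrArg v (hS 0)
  have hprod : ∀ a ∈ S, v (0 - a) = if 1 < v a then v t else 1 := by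
    intro a ha
    rw [zero_sub, Valuation.map_neg]
    rcases v.root_trichotomy hp h2 h3 ht (root_eq_of_prod_eq hS ha) with h | h | h
    · rw [if_pos h.1, h.2]
    · rw [h.1, if_neg (lt_irrefl _)]
    · rw [h.1, if_neg (lt_irrefl _)]
  rw [map_prod, Finset.prod_congr rfl hprod, Finset.prod_ite, Finset.prod_const,
    Finset.prod_const_one, mul_one, zero_pow (by omega), zero_mul, zero_sub, Valuation.map_neg,
    zero_sub, zero_sub, map_mul, map_mul, map_pow, map_pow, Valuation.map_neg, Valuation.map_neg,
    h4, hc, one_pow, one_pow, mul_one, mul_one] at h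
  exact pow_right_injective₀ (zero_lt_one.trans ht) ht.ne' (h.trans (pow_one _).symm)

include hp h2 h3 ht hS in
open Classical in
-- Evaluate at `4 / 3`, where the polynomial is a unit. Squaring makes the contributions explicit:
-- `(v t)^2` from the single pole and `(v t)⁻¹` from each root near `4 / 3`, so two of the latter
-- are needed to balance.
theorem Valuation.card_filter_near : (S.filter fun a ↦ v (a - 4 / 3) < 1).card = 2 := by
  obtain ⟨h4, hc, -, hc1, -⟩ := v.map_branch_points h2 h3
  have h := congrArg (fun x ↦ v x ^ 2) (hS (4 / 3))
  have ht0 : v t ≠ 0 := (zero_lt_one.trans ht).ne'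
  have hprod : ∀ a ∈ S, v (4 / 3 - a) ^ 2 =
      (if 1 < v a then v t ^ 2 else 1) * if v (a - 4 / 3) < 1 then (v t)⁻¹ else 1 := by
    intro a ha
    rw [Valuation.map_sub_swap]
    rcases v.root_trichotomy hp h2 h3 ht (root_eq_of_prod_eq hS ha) with h | h | h
    · have h5 := v.map_sub_eq_of_one_lt h.1 hc.le
      rw [if_pos h.1, h5, if_neg h.1.not_gt, h.2, mul_one]
    · rw [h.1, h.2.2.1, if_neg (lt_irrefl _), if_neg (lt_irrefl _), one_pow, mul_one]
    · rw [h.1, if_neg (lt_irrefl _), if_pos h.2.2.1, one_mul]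
      exact eq_inv_of_mul_eq_one_left h.2.2.2
  simp only [map_prod, ← Finset.prod_pow] at h
  rw [Finset.prod_congr rfl hprod, Finset.prod_mul_distrib, Finset.prod_ite, Finset.prod_ite,
    Finset.prod_const, Finset.prod_const_one, Finset.prod_const, Finset.prod_const_one,
    v.card_filter_pole hp h2 h3 ht hS, sub_self, zero_pow two_ne_zero, mul_zero, sub_zero, map_mul,
    map_pow, hc, hc1, one_pow, mul_one, mul_one, mul_one, one_pow, pow_one, inv_pow,
    mul_inv_eq_one₀ (pow_ne_zero _ ht0)] at h
  exact (pow_right_injective₀ (zero_lt_one.trans ht) ht.ne' h).symm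

end Infinity

section Zero

include hp h2 h3 in
/-- Over `T = 0` there is a totally ramified root. -/
theorem Valuation.exists_root_lt_one {S : Finset K}
    (hS : ∀ z : K, ∏ a ∈ S, (z - a) = z ^ p * (z - 1) - t * (z - 4) ^ (p - 2) * (z - 4 / 3) ^ 2)
    (ht : v t < 1) : ∃ a ∈ S, v t = v a ^ p := by
  obtain ⟨h4, hc, -⟩ := v.map_branch_points h2 h3
  have h := congrArg v (hS 0)
  rw [map_prod, zero_pow (by omega), zero_mul, zero_sub, Valuation.map_neg,
    zero_sub, zero_sub, map_mul, map_mul, map_pow, map_pow, Valuation.map_neg, Valuation.map_neg,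
    h4, hc, one_pow, one_pow, mul_one, mul_one] at h
  obtain ⟨a, ha, ha1⟩ : ∃ a ∈ S, v a < 1 := by
    by_contra! hall
    refine ht.not_ge (h ▸ Finset.one_le_prod' ?_)
    intro a ha
    rw [zero_sub, Valuation.map_neg]
    exact hall a ha
  refine ⟨a, ha, ?_⟩
  have hva := congrArg v (root_eq_of_prod_eq hS ha)
  have key (b : K) (hb : v b = 1) : v (a - b) = 1 := by
    rw [Valuation.map_sub_swap, sub_eq_add_neg, Valuation.map_add_eq_of_lt_left _
      (by rwa [Valuation.map_neg, hb]), hb]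
  simp only [map_mul, map_pow, key _ h4, key _ hc, key 1 (map_one v), one_pow, mul_one] at hva
  exact hva.symm

end Zero

section Unramified

include hp h2 h3 in
/-- If `T` is a unit then all roots and their differences with the critical points are units. -/
theorem Valuation.root_of_map_eq_one (ht : v t = 1) {a : K}
    (ha : a ^ p * (a - 1) = t * (a - 4) ^ (p - 2) * (a - 4 / 3) ^ 2) :
    v a = 1 ∧ v (a - 4) = 1 ∧ v (a - 4 / 3) = 1 := by
  obtain ⟨h4, hc, h41, hc1, h4c, hc4, -⟩ := v.map_branch_points h2 h3
  have hva := congrArg v ha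
  have hp2 : p - 2 ≠ 0 := by omega
  simp only [map_mul, map_pow, ht, one_mul] at hva
  have h4' (h : v (a - 4) < 1) : False := by
    have ha1 : v a = 1 := by
      simpa using v.map_sub_eq_one_of_lt (b := 0) h (by simpa using h4)
    rw [ha1, v.map_sub_eq_one_of_lt h h41, v.map_sub_eq_one_of_lt h h4c, one_pow, mul_one, one_pow,
      mul_one] at hva
    exact (pow_lt_one₀ zero_le h hp2).ne' hva
  have hc' (h : v (a - 4 / 3) < 1) : False := by
    have ha1 : v a = 1 := by
      simpa using v.map_sub_eq_one_of_lt (b := 0) h (by simpa using hc)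
    rw [ha1, v.map_sub_eq_one_of_lt h hc1, v.map_sub_eq_one_of_lt h hc4, one_pow, mul_one, one_pow,
      one_mul] at hva
    exact (pow_lt_one₀ zero_le h two_ne_zero).ne' hva
  rcases lt_or_ge 1 (v a) with h | h
  · exfalso
    rw [v.map_sub_eq_of_one_lt h (by rw [map_one]), v.map_sub_eq_of_one_lt h h4.le,
      v.map_sub_eq_of_one_lt h hc.le, ← pow_add, show p - 2 + 2 = p by omega] at hva
    exact h.ne' (mul_left_cancel₀ (pow_ne_zero _ (zero_lt_one.trans h).ne')
      (hva.trans (mul_one _).symm))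
  · have h4'' := (v.map_sub_le_one h h4.le).eq_of_not_lt h4'
    have hc'' := (v.map_sub_le_one h hc.le).eq_of_not_lt hc'
    refine ⟨h.eq_of_not_lt fun h' ↦ ?_, h4'', hc''⟩
    rw [h4'', hc'', one_pow, one_pow, mul_one] at hva
    have : v a ^ p * v (a - 1) < 1 := mul_lt_one_of_lt_of_le (pow_lt_one₀ zero_le h' (by omega))
      (v.map_sub_le_one h (by rw [map_one]))
    exact this.ne hva

end Unramified

end Valuation

/-! ### The fibre polynomial and its derivative -/

/-- The polynomial whose roots are the fibre over `t` of the rational function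
`X ^ p * (X - 1) / ((X - 4) ^ (p - 2) * (X - 4 / 3) ^ 2)`. -/
noncomputable def fiberPoly {L : Type*} [Field L] (p : ℕ) (t : L) : L[X] :=
  X ^ p * (X - 1) - C t * (X - C 4) ^ (p - 2) * (X - C (4 / 3)) ^ 2

theorem eval_fiberPoly {L : Type*} [Field L] (p : ℕ) (t z : L) :
    (fiberPoly p t).eval z = z ^ p * (z - 1) - t * (z - 4) ^ (p - 2) * (z - 4 / 3) ^ 2 := by
  simp [fiberPoly]

theorem three_ne_zero_of_charP {L : Type*} [Field L] {p : ℕ} [Fact p.Prime] [CharP L p]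
    (hp : 3 < p) : (3 : L) ≠ 0 := by
  intro h
  have := (CharP.cast_eq_zero_iff L p 3).mp (by exact_mod_cast h)
  exact absurd (Nat.le_of_dvd (by norm_num) this) (by omega)

theorem two_ne_zero_of_charP {L : Type*} [Field L] {p : ℕ} [Fact p.Prime] [CharP L p]
    (hp : 3 < p) : (2 : L) ≠ 0 := by
  intro h
  have := (CharP.cast_eq_zero_iff L p 2).mp (by exact_mod_cast h)
  exact absurd (Nat.le_of_dvd (by norm_num) this) (by omega)

/-- Eliminating `t`, a root off the poles has `f'(a) = a^p (1 - (a-1) ((p-2)/(a-4) + 2/(a-4/3)))`.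
Since `p - 2 = -2` in `L`, the numerator of the bracket is `(a-4)(a-4/3) + (16/3)(a-1) = a^2`; this
cancellation explains the constants `4` and `4 / 3`. -/
theorem eval_derivative_fiberPoly {L : Type*} [Field L] {p : ℕ} [Fact p.Prime] [CharP L p]
    (hp : 3 < p) {t a : L} (ha : (fiberPoly p t).eval a = 0) :
    (fiberPoly p t).derivative.eval a * ((a - 4) * (a - 4 / 3)) = a ^ (p + 2) := by
  have h3 : (3 : L) ≠ 0 := three_ne_zero_of_charP hp
  rw [eval_fiberPoly] at ha
  -- With `p = n + 3` the exponents `p - 2` and `p - 3` lose their truncated subtractions, and `n`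
  -- becomes `-3` in `L`.
  obtain ⟨n, rfl⟩ : ∃ n, p = n + 3 := ⟨p - 3, by omega⟩
  have hn : (n : L) = -3 := by
    have := CharP.cast_eq_zero L (n + 3)
    push_cast at this
    exact eq_neg_of_add_eq_zero_left this
  simp only [fiberPoly, show n + 3 - 2 = n + 1 by omega] at ha ⊢
  simp only [derivative_sub, derivative_mul, derivative_X_pow, derivative_X, derivative_one,
    derivative_C, derivative_X_sub_C_pow, eval_sub, eval_mul, eval_add, eval_pow, eval_X, eval_C,
    eval_one, eval_zero, Nat.cast_add, Nat.cast_one, Nat.cast_ofNat, hn,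
    Nat.add_sub_cancel]
  generalize hc : (4 / 3 : L) = c at ha ⊢
  have hc' : 3 * c = 4 := by rw [← hc, mul_div_cancel₀ _ h3]
  linear_combination (2 * c - 8) * ha + a ^ (n + 3) * (2 - a) * hc'

/-! ### Congruent roots -/

section Valuation

variable {K : Type*} [Field K] (V : ValuationSubring K)

theorem ValuationSubring.valuation_eval_sub_le (f : V[X]) {a b : K} (ha : V.valuation a ≤ 1)
    (hb : V.valuation b ≤ 1) : V.valuation ((f.map V.subtype).eval a - (f.map V.subtype).eval b) ≤
      V.valuation (a - b) := by
  lift a to V using (V.valuation_le_one_iff a).mp ha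
  lift b to V using (V.valuation_le_one_iff b).mp hb
  obtain ⟨c, hc⟩ := sub_dvd_eval_sub a b f
  have h1 (x : V) : (f.map V.subtype).eval (x : K) = (f.eval x : V) :=
    eval_map_apply (f := V.subtype) x
  rw [h1, h1, ← AddSubgroupClass.coe_sub, hc, MulMemClass.coe_mul, map_mul]
  exact mul_le_of_le_one_right' (V.valuation_le_one c)

/-- The uniqueness half of Hensel's lemma: with `d = b - a`, Taylor expansion gives `d (f'(a) + c d)
= 0`, and the second factor is a unit. -/
theorem ValuationSubring.eq_of_isRoot_of_valuation_derivative_eq_one (f : V[X]) {a b : K}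
    (ha : V.valuation a ≤ 1) (hb : V.valuation b ≤ 1) (hfa : (f.map V.subtype).eval a = 0)
    (hfb : (f.map V.subtype).eval b = 0)
    (hf' : V.valuation ((f.map V.subtype).derivative.eval a) = 1) (hab : V.valuation (b - a) < 1) :
    a = b := by
  lift a to V using (V.valuation_le_one_iff a).mp ha
  lift b to V using (V.valuation_le_one_iff b).mp hb
  have h1 (g : V[X]) (x : V) : (g.map V.subtype).eval (x : K) = (g.eval x : V) :=
    eval_map_apply (f := V.subtype) x
  rw [h1, ZeroMemClass.coe_eq_zero] at hfa hfb
  rw [derivative_map, h1] at hf'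
  obtain ⟨d, rfl⟩ : ∃ d, b = a + d := ⟨b - a, by ring⟩
  obtain ⟨c, hc⟩ := f.binomExpansion a d
  rw [hfa, hfb, zero_add] at hc
  have hd : d * (f.derivative.eval a + c * d) = 0 := by rw [hc]; ring
  rcases mul_eq_zero.mp hd with h | h
  · rw [h, add_zero]
  · exfalso
    have hd1 : V.valuation (d : K) < 1 := by simpa using hab
    rw [eq_neg_of_add_eq_zero_left h] at hf'
    push_cast at hf'
    rw [Valuation.map_neg, map_mul] at hf'
    exact (mul_lt_one_of_lt_of_le hd1 (V.valuation_le_one c)).ne ((mul_comm _ _).trans hf')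

variable {p : ℕ} (hp : 3 < p) {t : K} (h2 : V.valuation 2 = 1) (h3 : V.valuation 3 = 1)

include hp h2 h3 in
/-- If `T` is a unit then the roots are incongruent. -/
theorem ValuationSubring.root_eq_of_map_eq_one [Fact p.Prime] [CharP K p] (ht : V.valuation t = 1) {a b : K}
    (ha : (fiberPoly p t).eval a = 0) (hb : (fiberPoly p t).eval b = 0)
    (hab : V.valuation (b - a) < 1) : a = b := by
  have hroot {x : K} (hx : (fiberPoly p t).eval x = 0) :=
    V.valuation.root_of_map_eq_one hp h2 h3 ht (sub_eq_zero.mp ((eval_fiberPoly p t x).symm.trans hx))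
  obtain ⟨h4, hc, -⟩ := V.valuation.map_branch_points h2 h3
  have hmem {x : K} (hx : V.valuation x = 1) : x ∈ V := (V.valuation_le_one_iff x).mp hx.le
  let g : V[X] := X ^ p * (X - 1) - C ⟨t, hmem ht⟩ * (X - C ⟨4, hmem h4⟩) ^ (p - 2) *
    (X - C ⟨4 / 3, hmem hc⟩) ^ 2
  have hg : g.map V.subtype = fiberPoly p t := by simp [g, fiberPoly]
  obtain ⟨ha1, ha4, hac⟩ := hroot ha
  refine V.eq_of_isRoot_of_valuation_derivative_eq_one g ha1.le (hroot hb).1.le (hg ▸ ha)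
    (hg ▸ hb) ?_ hab
  have h := congrArg V.valuation (eval_derivative_fiberPoly hp ha)
  rw [map_mul, map_mul, ha4, hac, map_pow, ha1, one_pow, mul_one, mul_one] at h
  rwa [hg]

section Infinity

variable (ht : 1 < V.valuation t) {a b : K} (ha : (fiberPoly p t).eval a = 0)
  (hb : (fiberPoly p t).eval b = 0) (ha4 : V.valuation (a - 4) < 1) (hb4 : V.valuation (b - 4) < 1)

include hp h2 h3 ht ha hb ha4 hb4 in
-- Dividing the equations at `b` and `a` expresses the `(p-2)`-th power of the ratio through values
-- of `x^p (x-1) / (x-4/3)^2`, which are units differing by at most `b - a`. The bound by `b - a`,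
-- sharper than `< 1`, is what `near_four_unique` needs.
theorem ValuationSubring.near_four :
    V.valuation ((b - 4) / (a - 4)) = 1 ∧
      V.valuation (((b - 4) / (a - 4)) ^ (p - 2) - 1) ≤ V.valuation (b - a) := by
  obtain ⟨h4, hc, h41, -, h4c, -⟩ := V.valuation.map_branch_points h2 h3
  have hroot {x : K} (hx : (fiberPoly p t).eval x = 0) (hx4 : V.valuation (x - 4) < 1) :
      x ^ p * (x - 1) = t * (x - 4) ^ (p - 2) * (x - 4 / 3) ^ 2 ∧ V.valuation x = 1 ∧
      V.valuation (x - 1) = 1 ∧ V.valuation (x - 4 / 3) = 1 ∧ x - 4 ≠ 0 ∧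
      V.valuation (x - 4) ^ (p - 2) = (V.valuation t)⁻¹ := by
    have hx' := sub_eq_zero.mp ((eval_fiberPoly p t x).symm.trans hx)
    have h1 : V.valuation x = 1 := by
      simpa using V.valuation.map_sub_eq_one_of_lt (b := 0) hx4 (by simpa using h4)
    have hx1 := V.valuation.map_sub_eq_one_of_lt hx4 h41
    have hxc := V.valuation.map_sub_eq_one_of_lt hx4 h4c
    have h := congrArg V.valuation hx'
    simp only [map_mul, map_pow, h1, hx1, hxc, one_pow, mul_one] at h
    refine ⟨hx', h1, hx1, hxc, ?_, eq_inv_of_mul_eq_one_right h.symm⟩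
    intro h0
    rw [h0, map_zero, zero_pow (by omega), mul_zero] at h
    exact one_ne_zero h
  obtain ⟨ha', ha1, ha11, hac, ha0, hat⟩ := hroot ha ha4
  obtain ⟨hb', hb1, hb11, hbc, hb0, hbt⟩ := hroot hb hb4
  have ht0 : t ≠ 0 := by rintro rfl; simp at ht
  have hv : V.valuation (b - 4) = V.valuation (a - 4) :=
    (pow_left_inj₀ zero_le zero_le (by omega : p - 2 ≠ 0)).mp (hbt.trans hat.symm)
  refine ⟨by rw [map_div₀, hv, div_self ((Valuation.ne_zero_iff _).mpr ha0)], ?_⟩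
  have hmem {x : K} (hx : V.valuation x = 1) : x ∈ V := (V.valuation_le_one_iff x).mp hx.le
  have hm1 : V.valuation (a ^ p * (a - 1)) = 1 := by simp [ha1, ha11]
  have hm2 : V.valuation ((a - 4 / 3) ^ 2) = 1 := by simp [hac]
  let g : V[X] := C ⟨_, hmem hm1⟩ * (X - C ⟨4 / 3, hmem hc⟩) ^ 2 -
    C ⟨_, hmem hm2⟩ * (X ^ p * (X - 1))
  have hg (x : K) : (g.map V.subtype).eval x =
      a ^ p * (a - 1) * (x - 4 / 3) ^ 2 - (a - 4 / 3) ^ 2 * (x ^ p * (x - 1)) := by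
    simp [g]
  have hle := V.valuation_eval_sub_le g ha1.le hb1.le
  have key : (((b - 4) / (a - 4)) ^ (p - 2) - 1) * ((b - 4 / 3) ^ 2 * (a ^ p * (a - 1))) =
      (g.map V.subtype).eval a - (g.map V.subtype).eval b := by
    rw [hg, hg, hb', ha', div_pow]
    have := pow_ne_zero (p - 2) ha0
    field_simp
    ring
  have h := congrArg V.valuation key
  rw [map_mul, map_mul, map_pow, hbc, hm1, one_pow, mul_one, mul_one] at h
  rw [h, Valuation.map_sub_swap _ b a]
  exact hle

include hp h2 h3 ht ha hb ha4 hb4 in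
-- For `u` the ratio, `u^(p-2) - 1` is `u - 1` times a geometric sum congruent to `p - 2 = -2`, a
-- unit. So `v (u - 1) ≤ v (b - a) = v (u - 1) v (a - 4)`, which is impossible unless `u = 1`.
theorem ValuationSubring.near_four_unique [CharP K p]
    (hu : V.valuation ((b - 4) / (a - 4) - 1) < 1) : a = b := by
  obtain ⟨h1, hle⟩ := V.near_four hp h2 h3 ht ha hb ha4 hb4
  set u := (b - 4) / (a - 4) with hudef
  have ha0 : a - 4 ≠ 0 := by
    intro h0
    rw [hudef, h0, div_zero, map_zero] at h1
    exact zero_ne_one h1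
  have hp2 : V.valuation ((p - 2 : ℕ) : K) = 1 := by
    rw [Nat.cast_sub (by omega), CharP.cast_eq_zero, zero_sub, Valuation.map_neg]
    exact_mod_cast h2
  have hsum : V.valuation (∑ i ∈ Finset.range (p - 2), u ^ i) = 1 := by
    rw [← hp2]
    refine Valuation.map_eq_of_sub_lt _ ?_
    rw [hp2]
    have : ∑ i ∈ Finset.range (p - 2), u ^ i - ((p - 2 : ℕ) : K) =
        ∑ i ∈ Finset.range (p - 2), (u ^ i - 1) := by simp
    rw [this]
    refine Valuation.map_sum_lt _ one_ne_zero fun i _ ↦ ?_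
    have := V.valuation_eval_sub_le (X ^ i) h1.le (map_one V.valuation).le
    simp only [Polynomial.map_pow, map_X, eval_pow, eval_X, one_pow] at this
    exact this.trans_lt hu
  have hgeom : (∑ i ∈ Finset.range (p - 2), u ^ i) * (u - 1) = u ^ (p - 2) - 1 := geom_sum_mul u _
  rw [← hgeom, map_mul, hsum, one_mul] at hle
  have hba : b - a = (u - 1) * (a - 4) := by
    rw [hudef, sub_mul, div_mul_cancel₀ _ ha0]; ring
  by_contra hne
  have hu0 : 0 < V.valuation (u - 1) := by
    rw [zero_lt_iff, Valuation.ne_zero_iff]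
    intro h0
    rw [h0, zero_mul] at hba
    exact hne (sub_eq_zero.mp hba).symm
  rw [hba, map_mul] at hle
  exact (mul_lt_of_lt_one_right hu0 ha4).not_ge hle

end Infinity

end Valuation

/-! ### Inertial automorphisms -/

/-- The automorphism `σ` acts trivially on the residue field of `V`. -/
def ValuationSubring.IsInertial {K : Type*} [Field K] (V : ValuationSubring K) (σ : K ≃+* K) :
    Prop :=
  ∀ x, V.valuation x ≤ 1 → V.valuation (σ x - x) < 1

section Inertia

variable {K : Type*} [Field K] {V : ValuationSubring K} {σ : K ≃+* K} (hσ : V.IsInertial σ)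

include hσ in
theorem ValuationSubring.IsInertial.map_lt_one {x : K} (hx : V.valuation x < 1) :
    V.valuation (σ x) < 1 := by
  have : σ x = (σ x - x) + x := by ring
  rw [this]
  exact Valuation.map_add_lt _ (hσ x hx.le) hx

include hσ in
theorem ValuationSubring.IsInertial.one_lt_map {x : K} (hx : 1 < V.valuation x) :
    1 < V.valuation (σ x) := by
  have h0 : x ≠ 0 := by rintro rfl; simp at hx
  have := hσ.map_lt_one (x := x⁻¹) (by rw [map_inv₀]; exact inv_lt_one_of_one_lt₀ hx)
  rw [map_inv₀, map_inv₀] at this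
  exact (inv_lt_one₀ (by simpa [zero_lt_iff] using h0)).mp this

variable {p : ℕ} [Fact p.Prime] [CharP K p] (hp : 3 < p) {t : K} (h2 : V.valuation 2 = 1)
  (h3 : V.valuation 3 = 1) (ht : 1 < V.valuation t)

include hσ hp h2 h3 ht in
-- The ratio `u` satisfies `σ u = u⁻¹`, while inertia gives `σ u ≡ u`; hence `u ≡ ±1`. As `p - 2` is
-- odd and `2` is a unit, `u ≡ -1` contradicts `u^(p-2) ≡ 1`, so `u ≡ 1` and `near_four_unique`
-- applies.
theorem ValuationSubring.IsInertial.apply_eq_of_near_four {a : K}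
    (ha : (fiberPoly p t).eval a = 0) (hb : (fiberPoly p t).eval (σ a) = 0)
    (ha4 : V.valuation (a - 4) < 1) (h : σ (σ a) = a) : σ a = a := by
  have hσ4 : σ 4 = 4 := map_ofNat σ 4
  have hb4 : V.valuation (σ a - 4) < 1 := by simpa [hσ4] using hσ.map_lt_one ha4
  obtain ⟨h1, hle⟩ := V.near_four hp h2 h3 ht ha hb ha4 hb4
  refine (V.near_four_unique hp h2 h3 ht ha hb ha4 hb4 ?_).symm
  set u := (σ a - 4) / (a - 4) with hu
  have hσu : σ u = u⁻¹ := by simp [hu, h, hσ4]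
  have hu0 : u ≠ 0 := by intro h0; simp [h0] at h1
  have h1' := hσ u h1.le
  have hsq : (σ u - u) * u = -((u - 1) * (u + 1)) := by
    rw [hσu, sub_mul, inv_mul_cancel₀ hu0]; ring
  have hsq' := congrArg V.valuation hsq
  rw [map_mul, h1, mul_one, Valuation.map_neg, map_mul] at hsq'
  rw [hsq'] at h1'
  by_contra hge
  have hu1 : V.valuation (u + 1) < 1 := by
    by_contra hge'
    exact h1'.not_ge (one_le_mul (not_lt.mp hge) (not_lt.mp hge'))
  have hodd : Odd (p - 2) := by
    have := (Fact.out : p.Prime).eq_two_or_odd'.resolve_left (by omega)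
    obtain ⟨m, hm⟩ := this
    exact ⟨m - 1, by omega⟩
  have h5 : V.valuation (u ^ (p - 2) + 1) < 1 := by
    have := V.valuation_eval_sub_le (X ^ (p - 2)) (a := u) (b := -1) h1.le (by simp)
    simp only [Polynomial.map_pow, map_X, eval_pow, eval_X, hodd.neg_one_pow, sub_neg_eq_add]
      at this
    exact this.trans_lt hu1
  have h6 : V.valuation (u ^ (p - 2) - 1) < 1 := by
    refine hle.trans_lt ?_
    have : σ a - a = (σ a - 4) - (a - 4) := by ring
    rw [this]
    exact Valuation.map_sub_lt _ hb4 ha4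
  have h7 : V.valuation 2 < 1 := by
    have : (2 : K) = (u ^ (p - 2) + 1) - (u ^ (p - 2) - 1) := by ring
    rw [this]
    exact Valuation.map_sub_lt _ h5 h6
  exact h7.ne h2

end Inertia

/-! ### Recognizing symmetric groups -/

section PermGroup

open Equiv

theorem Subgroup.eq_top_of_forall_swap_mem {α : Type*} [Finite α] [DecidableEq α]
    (H : Subgroup (Perm α)) (z : α) (h : ∀ y, y ≠ z → swap z y ∈ H) : H = ⊤ := by
  rw [eq_top_iff, ← Equiv.Perm.closure_isSwap, Subgroup.closure_le]
  rintro _ ⟨x, y, hxy, rfl⟩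
  by_cases hx : x = z
  · subst hx; exact h y hxy.symm
  by_cases hy : y = z
  · subst hy; rw [swap_comm]; exact h x hxy
  rw [← swap_mul_swap_mul_swap (x := y) (y := z) (z := x) hy hxy.symm]
  exact H.mul_mem (H.mul_mem (h x hx) (swap_comm z y ▸ h y hy)) (h x hx)

/-- A permutation group on `p + 1` points without a common fixed point whose order is divisible by
`p` and that contains a transposition is the full symmetric group. -/
theorem Subgroup.eq_top_of_prime_dvd_of_isSwap_mem {α : Type*} [Fintype α] [DecidableEq α] {p : ℕ}
    [hp : Fact p.Prime] (hα : Fintype.card α = p + 1) (H : Subgroup (Perm α))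
    (hpH : p ∣ Nat.card H) (hswap : ∃ τ ∈ H, τ.IsSwap) (hfix : ∀ z, ∃ g ∈ H, g z ≠ z) :
    H = ⊤ := by
  obtain ⟨⟨c, hcH⟩, hc⟩ := exists_prime_orderOf_dvd_card' p hpH
  rw [Subgroup.orderOf_mk] at hc
  -- Since `p + 1 < 2p`, there is no room for two disjoint `p`-cycles; `c` therefore misses exactly
  -- one point.
  have hcyc : c.IsCycle := Equiv.Perm.isCycle_of_prime_order' (hc.symm ▸ hp.out) (by
    have := hp.out.two_le
    omega)
  have hsupp : c.support.card = p := by rw [← hcyc.orderOf, hc]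
  obtain ⟨z, hz⟩ : ∃ z, c.supportᶜ = {z} := by
    rw [← Finset.card_eq_one, Finset.card_compl]; omega
  have hmem (x : α) (hx : x ≠ z) : c x ≠ x := by
    rw [← Equiv.Perm.mem_support]
    by_contra h
    rw [← Finset.mem_compl, hz, Finset.mem_singleton] at h
    exact hx h
  have hcz : c z = z := by
    rw [← Equiv.Perm.notMem_support, ← Finset.mem_compl, hz, Finset.mem_singleton]
  have hpow (x y : α) (hx : x ≠ z) (hy : y ≠ z) : ∃ g ∈ H, g x = y ∧ g z = z := by
    obtain ⟨i, hi⟩ := hcyc.exists_zpow_eq (hmem x hx) (hmem y hy)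
    exact ⟨c ^ i, H.zpow_mem hcH i, hi, Equiv.Perm.zpow_apply_eq_self_of_apply_eq_self hcz i⟩
  have htrans (x : α) : ∃ g ∈ H, g z = x := by
    by_cases hx : x = z
    · exact ⟨1, H.one_mem, hx.symm⟩
    obtain ⟨g, hg, hgz⟩ := hfix z
    obtain ⟨g', hg', hgx, -⟩ := hpow (g z) x hgz hx
    exact ⟨g' * g, H.mul_mem hg' hg, hgx⟩
  obtain ⟨τ, hτ, a, b, hab, rfl⟩ := hswap
  obtain ⟨g, hg, rfl⟩ := htrans a
  -- Conjugation moves one end of the transposition to `z`; powers of `c`, which fix `z`, then move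
  -- the other end to any other point.
  have h1 : swap z (g⁻¹ b) ∈ H := by
    have := H.mul_mem (H.mul_mem (H.inv_mem hg) hτ) hg
    have h := swap_apply_apply g⁻¹ (g z) b
    rw [inv_inv, show g⁻¹ (g z) = z by simp] at h
    rwa [h]
  have hb : g⁻¹ b ≠ z := by
    rintro rfl
    simp at hab
  refine H.eq_top_of_forall_swap_mem z fun y hy ↦ ?_
  obtain ⟨g', hg', hgy, hgz⟩ := hpow _ y hb hy
  have := H.mul_mem (H.mul_mem hg' h1) (H.inv_mem hg')
  rwa [Equiv.mul_swap_eq_swap_mul, mul_inv_cancel_right, hgy, hgz] at this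

/-- Without fixed points only double transpositions and 4-cycles remain, and the former have square
`1`. -/
theorem Equiv.Perm.sign_eq_neg_one_of_card_eq_four {α : Type*} [Fintype α] [DecidableEq α]
    (hα : Fintype.card α = 4) (σ : Perm α) (hσ : ∀ x, σ x ≠ x) (hσ2 : σ ^ 2 ≠ 1) :
    Equiv.Perm.sign σ = -1 := by
  have key : ∀ σ : Perm (Fin 4), (∀ x, σ x ≠ x) → σ ^ 2 ≠ 1 → Equiv.Perm.sign σ = -1 := by decide
  let e := Fintype.equivFinOfCardEq hα
  rw [← Equiv.Perm.sign_permCongr e σ]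
  apply key
  · intro x h
    apply hσ (e.symm x)
    rw [Equiv.permCongr_apply] at h
    rw [← e.symm_apply_apply (σ _), h]
  · intro h
    apply hσ2
    ext x
    have := Equiv.ext_iff.mp h (e x)
    simpa [pow_two] using this

/-- A permutation group on `4` points whose order is divisible by `12` and that contains an odd
permutation is the full symmetric group. -/
theorem Subgroup.eq_top_of_card_eq_four {α : Type*} [Fintype α] [DecidableEq α]
    (hα : Fintype.card α = 4) (H : Subgroup (Perm α)) (h3 : 3 ∣ Nat.card H) (h4 : 4 ∣ Nat.card H)
    (hodd : ∃ σ ∈ H, Equiv.Perm.sign σ = -1) : H = ⊤ := by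
  have hcard : Nat.card H * H.index = 24 := by
    rw [H.card_mul_index, Nat.card_eq_fintype_card, Fintype.card_perm, hα]; rfl
  have h12 : 12 ∣ Nat.card H := Nat.Coprime.mul_dvd_of_dvd_of_dvd (by norm_num) h3 h4
  obtain ⟨m, hm⟩ := h12
  rw [hm] at hcard
  have hidx : m * H.index = 2 := by nlinarith
  have : H.index ∣ 2 := ⟨m, by rw [mul_comm, hidx]⟩
  rcases (Nat.dvd_prime Nat.prime_two).mp this with h | h
  · exact Subgroup.index_eq_one.mp h
  · obtain ⟨σ, hσ, hσ1⟩ := hodd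
    have hα : Nontrivial α := Fintype.one_lt_card_iff_nontrivial.mp (by omega)
    rw [Equiv.Perm.eq_alternatingGroup_of_index_eq_two h, Equiv.Perm.mem_alternatingGroup, hσ1]
      at hσ
    exact absurd hσ (by decide)

end PermGroup

/-! ### The roots of the quartic in characteristic three -/

section CharThree

variable {K : Type*} [Field K] [CharP K 3] {V : ValuationSubring K} {t : K}

theorem add_one_pow_three_of_charP (a : K) : (a + 1) ^ 3 = a ^ 3 + 1 := by
  rw [add_pow_char, one_pow]

/-- In characteristic three `4 a^3 + 1 = a^3 + 1` is a cube, so `-1` is the only critical point. -/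
theorem eval_derivative_quartic (a : K) :
    (X ^ 4 + X + C t : K[X]).derivative.eval a = (a + 1) ^ 3 := by
  have h3 : (3 : K) = 0 := by exact_mod_cast CharP.cast_eq_zero K 3
  simp only [derivative_add, derivative_X_pow, derivative_X, derivative_C, eval_add, eval_mul,
    eval_C, eval_pow, eval_X, eval_one, eval_zero, Nat.cast_ofNat]
  norm_num
  linear_combination (-a ^ 2 - a + a ^ 3) * h3

/-- The equation factors as `t = -a (a + 1)^3`, from which the value of `a` can be read off. -/
theorem Valuation.map_pow_four_of_one_lt {Γ : Type*} [LinearOrderedCommGroupWithZero Γ]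
    (v : Valuation K Γ) (ht : 1 < v t) {a : K} (ha : a ^ 4 + a + t = 0) :
    1 < v a ∧ v t = v a ^ 4 := by
  have h1 : t = -a * (a + 1) ^ 3 := by
    rw [add_one_pow_three_of_charP]; linear_combination ha
  have h2 := congrArg v h1
  rw [map_mul, Valuation.map_neg, map_pow] at h2
  have ha1 : 1 < v a := by
    by_contra! h
    have h3 : v (a + 1) ≤ 1 := (Valuation.map_add v a 1).trans (max_le h (by rw [map_one]))
    exact ht.not_ge (h2 ▸ mul_le_one' h (pow_le_one' h3 3))
  refine ⟨ha1, ?_⟩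
  rw [h2, Valuation.map_add_eq_of_lt_left v (by rwa [map_one]), pow_succ' (v a) 3]

theorem Valuation.root_quartic_of_map_eq_one {Γ : Type*} [LinearOrderedCommGroupWithZero Γ]
    (v : Valuation K Γ) (ht : v t = 1) {a : K} (ha : a ^ 4 + a + t = 0) :
    v a = 1 ∧ v (a + 1) = 1 := by
  have h1 : t = -a * (a + 1) ^ 3 := by
    rw [add_one_pow_three_of_charP]; linear_combination ha
  have h2 := congrArg v h1
  rw [map_mul, Valuation.map_neg, map_pow, ht] at h2
  rcases lt_or_ge 1 (v a) with h | h
  · rw [Valuation.map_add_eq_of_lt_left v (by rwa [map_one]), ← pow_succ'] at h2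
    exact absurd h2 (one_lt_pow₀ h (by norm_num)).ne
  · have h3 : v (a + 1) ≤ 1 := (Valuation.map_add v a 1).trans (max_le h (by rw [map_one]))
    have h4 : v (a + 1) = 1 := h3.eq_of_not_lt fun h' ↦
      ((mul_comm (v a) _).trans_lt
        (mul_lt_one_of_lt_of_le (pow_lt_one₀ zero_le h' (by norm_num)) h)).ne h2.symm
    rw [h4, one_pow, mul_one] at h2
    exact ⟨h2.symm, h4⟩

theorem Valuation.exists_root_quartic_lt_one {Γ : Type*} [LinearOrderedCommGroupWithZero Γ]
    (v : Valuation K Γ) {S : Finset K} (hS : ∀ z : K, ∏ a ∈ S, (z - a) = z ^ 4 + z + t)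
    (ht : v t < 1) : ∃ a ∈ S, v t = v (a + 1) ^ 3 := by
  have h := congrArg v (hS (-1))
  rw [map_prod, show ((-1) ^ 4 + -1 + t : K) = t by ring] at h
  obtain ⟨a, ha, ha1⟩ : ∃ a ∈ S, v (-1 - a) < 1 := by
    by_contra! hall
    exact ht.not_ge (h ▸ Finset.one_le_prod' hall)
  have ha0 : a ^ 4 + a + t = 0 := by rw [← hS, Finset.prod_eq_zero ha (sub_self a)]
  rw [show -1 - a = -(a + 1) by ring, Valuation.map_neg] at ha1
  have h1 : t = -a * (a + 1) ^ 3 := by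
    rw [add_one_pow_three_of_charP]; linear_combination ha0
  have hva : v a = 1 := by
    have := Valuation.map_add_eq_of_lt_right v (x := a + 1) (y := -1) (by simpa using ha1)
    simpa using this
  refine ⟨a, ha, ?_⟩
  conv_lhs => rw [h1, map_mul, Valuation.map_neg, hva, one_mul, map_pow]

theorem ValuationSubring.root_quartic_eq_of_map_eq_one (ht : V.valuation t = 1) {a b : K}
    (ha : a ^ 4 + a + t = 0) (hb : b ^ 4 + b + t = 0) (hab : V.valuation (b - a) < 1) : a = b := by
  have ha' := V.valuation.root_quartic_of_map_eq_one ht ha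
  have hb' := V.valuation.root_quartic_of_map_eq_one ht hb
  let g : V[X] := X ^ 4 + X + C ⟨t, (V.valuation_le_one_iff t).mp ht.le⟩
  have hg : g.map V.subtype = X ^ 4 + X + C t := by simp [g]
  refine V.eq_of_isRoot_of_valuation_derivative_eq_one g ha'.1.le hb'.1.le ?_ ?_ ?_ hab
  · simpa [hg] using ha
  · simpa [hg] using hb
  · rw [hg, eval_derivative_quartic, map_pow, ha'.2, one_pow]

/-- Subtracting the two equations gives `(u - 1)(u^3 + u^2 + u + 1 + a⁻³) = 0` for `u = b / a`. For
`u ≡ 1` the second factor is congruent to `4 = 1`, so it is nonzero. -/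
theorem ValuationSubring.root_quartic_eq_of_one_lt (ht : 1 < V.valuation t) {a b : K}
    (ha : a ^ 4 + a + t = 0) (hb : b ^ 4 + b + t = 0) (hab : V.valuation (b / a - 1) < 1) :
    a = b := by
  have h3 : (3 : K) = 0 := by exact_mod_cast CharP.cast_eq_zero K 3
  obtain ⟨ha1, -⟩ := V.valuation.map_pow_four_of_one_lt ht ha
  have ha0 : a ≠ 0 := by rintro rfl; simp at ha1
  set u := b / a with hu
  have hb' : b = u * a := by rw [hu, div_mul_cancel₀ _ ha0]
  have h : (u - 1) * (u ^ 3 + u ^ 2 + u + 1 + (a⁻¹) ^ 3) = 0 := by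
    have h1 : a ^ 4 * ((u - 1) * (u ^ 3 + u ^ 2 + u + 1 + (a⁻¹) ^ 3)) = 0 := by
      have : a ^ 4 * (a⁻¹) ^ 3 = a := by field_simp
      linear_combination (u - 1) * this + hb - ha - (b ^ 3 + b ^ 2 * u * a + b * u ^ 2 * a ^ 2 +
        u ^ 3 * a ^ 3 + 1) * hb'
    exact (mul_eq_zero.mp h1).resolve_left (pow_ne_zero 4 ha0)
  rcases mul_eq_zero.mp h with h | h
  · rw [hb', sub_eq_zero.mp h, one_mul]
  · exfalso
    have hu1 : V.valuation u ≤ 1 := by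
      have : u = (u - 1) + 1 := by ring
      rw [this]
      exact (Valuation.map_add _ _ _).trans (max_le hab.le (map_one V.valuation).le)
    have h4 := V.valuation_eval_sub_le (X ^ 3 + X ^ 2 + X) hu1 (map_one V.valuation).le
    simp only [Polynomial.map_add, Polynomial.map_pow, map_X, eval_add, eval_pow, eval_X] at h4
    have h5 : V.valuation ((a⁻¹) ^ 3) < 1 := by
      rw [map_pow, map_inv₀]
      exact pow_lt_one₀ zero_le (inv_lt_one_of_one_lt₀ ha1) (by norm_num)
    have h6 : (-1 : K) = (u ^ 3 + u ^ 2 + u - (1 ^ 3 + 1 ^ 2 + 1)) + (a⁻¹) ^ 3 := by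
      linear_combination -h + h3
    have h7 := congrArg V.valuation h6
    rw [Valuation.map_neg, map_one] at h7
    exact (Valuation.map_add_lt _ (h4.trans_lt hab) h5).ne h7.symm

variable {σ : K ≃+* K} (hσ : V.IsInertial σ) (ht : 1 < V.valuation t) {a b : K}
  (ha : a ^ 4 + a + t = 0)

include hσ ht ha in
-- The ratio `b / a` is a unit, and inertia gives `σ b / a ≡ b / a`; thus `σ b / b ≡ 1`.
theorem ValuationSubring.IsInertial.apply_eq_of_apply_eq (hb : b ^ 4 + b + t = 0)
    (hb' : σ b ^ 4 + σ b + t = 0) (h : σ a = a) : σ b = b := by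
  obtain ⟨ha1, ha4⟩ := V.valuation.map_pow_four_of_one_lt ht ha
  obtain ⟨hb1, hb4⟩ := V.valuation.map_pow_four_of_one_lt ht hb
  have ha0 : a ≠ 0 := by rintro rfl; simp at ha1
  have hb0 : b ≠ 0 := by rintro rfl; simp at hb1
  have hab : V.valuation b = V.valuation a :=
    (pow_left_inj₀ zero_le zero_le (by norm_num : 4 ≠ 0)).mp (hb4.symm.trans ha4)
  have hu : V.valuation (b / a) = 1 := by
    rw [map_div₀, hab, div_self ((Valuation.ne_zero_iff _).mpr ha0)]
  refine (V.root_quartic_eq_of_one_lt ht hb hb' ?_).symm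
  have h1 := hσ _ hu.le
  rw [map_div₀, h] at h1
  have h2 : σ b / b - 1 = (σ b / a - b / a) * (a / b) := by field_simp
  rw [h2, map_mul]
  refine mul_lt_one_of_lt_of_le h1 ?_
  rw [map_div₀, hab, div_self ((Valuation.ne_zero_iff _).mpr ha0)]

include hσ ht ha in
-- For `u = σ a / a`, `σ u = u⁻¹` and `σ u ≡ u` give `u ≡ ±1`; the case `u ≡ 1` forces `σ a = a`.
theorem ValuationSubring.IsInertial.apply_div_of_involution (hb : σ a ^ 4 + σ a + t = 0)
    (h : σ (σ a) = a) : σ a = a ∨ V.valuation (σ a / a + 1) < 1 := by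
  obtain ⟨ha1, ha4⟩ := V.valuation.map_pow_four_of_one_lt ht ha
  obtain ⟨hb1, hb4⟩ := V.valuation.map_pow_four_of_one_lt ht hb
  have ha0 : a ≠ 0 := by rintro rfl; simp at ha1
  have hab : V.valuation (σ a) = V.valuation a :=
    (pow_left_inj₀ zero_le zero_le (by norm_num : 4 ≠ 0)).mp (hb4.symm.trans ha4)
  have hu1 : V.valuation (σ a / a) = 1 := by
    rw [map_div₀, hab, div_self ((Valuation.ne_zero_iff _).mpr ha0)]
  by_contra! hne
  have h1 : 1 ≤ V.valuation (σ a / a - 1) := by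
    by_contra! h1
    exact hne.1 (V.root_quartic_eq_of_one_lt ht ha hb h1).symm
  set u := σ a / a with hu
  have hσu : σ u = u⁻¹ := by simp [hu, h]
  have hu0 : u ≠ 0 := by intro h0; simp [h0] at hu1
  have h1' := hσ u hu1.le
  have hsq : (σ u - u) * u = -((u - 1) * (u + 1)) := by
    rw [hσu, sub_mul, inv_mul_cancel₀ hu0]; ring
  have hsq' := congrArg V.valuation hsq
  rw [map_mul, hu1, mul_one, Valuation.map_neg, map_mul] at hsq'
  rw [hsq'] at h1'
  exact h1'.not_ge (one_le_mul h1 hne.2)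

end CharThree

/-! ### Galois action on the roots of a polynomial -/

section SplittingField

variable {k K : Type*} [Field k] [Field K] [Algebra k K] {f : k[X]} [f.IsSplittingField k K]

theorem Polynomial.prod_rootSet_sub (hf : f.Monic) (hs : f.Separable) (z : K) :
    ∏ a ∈ (f.rootSet K).toFinset, (z - a) = (f.map (algebraMap k K)).eval z := by
  have hspl := IsSplittingField.splits K f
  conv_rhs => rw [hspl.eq_prod_roots_of_monic (hf.map _), eval_multiset_prod]
  have hnd : (f.aroots K).Nodup := nodup_roots hs.map
  classical
  have : (f.rootSet K).toFinset = (f.aroots K).toFinset := by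
    ext x; simp [rootSet_def]
  rw [this, Multiset.map_map, Finset.prod, Multiset.toFinset_val, hnd.dedup]
  simp

theorem Polynomial.IsSplittingField.toPermHom_injective :
    Function.Injective (MulAction.toPermHom (K ≃ₐ[k] K) (f.rootSet K)) := by
  rw [injective_iff_map_eq_one]
  intro σ hσ
  have h : (σ : K →ₐ[k] K) = AlgHom.id k K := by
    refine AlgHom.ext_of_adjoin_eq_top (IsSplittingField.adjoin_rootSet K f) fun a ha ↦ ?_
    exact congrArg Subtype.val (Equiv.ext_iff.mp hσ ⟨a, ha⟩)
  ext x
  exact DFunLike.congr_fun h x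

theorem Polynomial.Separable.of_forall_derivative_ne_zero (hf : f ≠ 0)
    (h : ∀ a : K, (f.map (algebraMap k K)).eval a = 0 →
      (f.map (algebraMap k K)).derivative.eval a ≠ 0) : f.Separable := by
  classical
  rw [← separable_map (algebraMap k K)]
  have h0 : f.map (algebraMap k K) ≠ 0 := (Polynomial.map_ne_zero_iff (algebraMap k K).injective).mpr hf
  rw [← nodup_roots_iff_of_splits h0 (IsSplittingField.splits K f), Multiset.nodup_iff_count_le_one]
  intro a
  rw [count_roots]
  by_contra! hlt
  obtain ⟨h1, h2⟩ := (one_lt_rootMultiplicity_iff_isRoot h0).mp hlt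
  exact h a h1 h2

end SplittingField

namespace PrimeDivisor

theorem valuation_eq_one_of_algebraMap_eq {E K : Type*} [Field E] [Field K] [Algebra E K]
    (Q : PrimeDivisor E K) {c : E} (hc : c ≠ 0) {x : K} (hx : algebraMap E K c = x) :
    Q.ring.valuation x = 1 :=
  hx ▸ Q.ring.valuation_algebraMap_eq_one Q.algebraMap_mem hc

/-- An inertia group over a given rational place. -/
theorem exists_inertia_of_generator {E : Type*} [Field E] [Finite E] (K : Type*) [Field K] [Algebra E K] [Algebra (RatFunc E) K]
    [IsScalarTower E (RatFunc E) K] [FiniteDimensional (RatFunc E) K] [IsGalois (RatFunc E) K]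
    {θ : RatFunc E} (hθ : θ = RatFunc.X ∨ θ = RatFunc.X⁻¹) :
    ∃ (Q : PrimeDivisor E K) (I : Subgroup (K ≃ₐ[RatFunc E] K)),
      Q.ring.valuation (algebraMap (RatFunc E) K θ) < 1 ∧
      (∀ σ ∈ I, Q.ring.IsInertial σ.toRingEquiv) ∧
      ∀ (y : K) (n : ℕ), Q.ring.valuation (algebraMap (RatFunc E) K θ) = Q.ring.valuation y ^ n →
        n ∣ Nat.card I := by
  obtain ⟨P, hP⟩ := exists_valuation_lt_one E hθ
  obtain ⟨Q, hQ⟩ := exists_liesOver (K := K) P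
  obtain ⟨I, h1, h2, h3⟩ := Q.exists_inertia
  have hlt : Q.ring.valuation (algebraMap (RatFunc E) K θ) < 1 := by
    rw [← below_valuation_lt_one_iff]
    change (Q.ring.comap (algebraMap (RatFunc E) K)).valuation θ < 1
    rwa [hQ]
  exact ⟨Q, I, hlt, fun σ hσ ↦ h2 σ hσ, fun y n hy ↦ h1 ▸ h3 θ hθ hlt y n hy⟩

end PrimeDivisor

/-! ### The generic fibre over `E(T)` -/

section FiberPoly

theorem map_realizingPoly {E L : Type*} [Field E] [Field L] (p : ℕ) (φ : E[X] →+* L) :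
    (realizingPoly E p).map φ = fiberPoly p (φ X) := by
  have h : φ (C (4 / 3)) = 4 / 3 := by
    rw [← RingHom.comp_apply φ C, map_div₀, map_ofNat, map_ofNat]
  have h4 : φ (C 4) = 4 := by rw [← RingHom.comp_apply φ C, map_ofNat]
  simp only [realizingPoly, fiberPoly, Polynomial.map_sub, Polynomial.map_mul, Polynomial.map_pow,
    map_X, map_C, Polynomial.map_one, h, h4]

/-- Stated over a ring, so that it serves both `fiberPoly` over a field and `realizingPoly` over
`E[X]`. -/
theorem monic_X_pow_mul_sub {R : Type*} [CommRing R] [Nontrivial R] {p : ℕ} (hp : 3 < p) (t a b : R) :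
    (X ^ p * (X - 1) - C t * (X - C a) ^ (p - 2) * (X - C b) ^ 2 : R[X]).Monic ∧
    (X ^ p * (X - 1) - C t * (X - C a) ^ (p - 2) * (X - C b) ^ 2 : R[X]).natDegree = p + 1 := by
  have h1 : (X ^ p * (X - C 1) : R[X]).Monic := (monic_X_pow p).mul (monic_X_sub_C 1)
  have h2 : (X ^ p * (X - C 1) : R[X]).natDegree = p + 1 := by
    rw [(monic_X_pow p).natDegree_mul (monic_X_sub_C 1), natDegree_X_pow, natDegree_X_sub_C]
  have h3 : (C t * (X - C a) ^ (p - 2) * (X - C b) ^ 2 : R[X]).natDegree ≤ p := by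
    refine (natDegree_mul_le).trans ?_
    have h4 := natDegree_C_mul_le t ((X - C a) ^ (p - 2))
    rw [(monic_X_sub_C a).natDegree_pow, natDegree_X_sub_C] at h4
    rw [(monic_X_sub_C b).natDegree_pow, natDegree_X_sub_C]
    omega
  rw [map_one] at h1 h2
  refine ⟨h1.sub_of_left (degree_lt_degree (by omega)), ?_⟩
  rw [natDegree_sub_eq_left_of_natDegree_lt (by omega), h2]

theorem fiberPoly_monic {L : Type*} [Field L] {p : ℕ} (hp : 3 < p) (t : L) :
    (fiberPoly p t).Monic := (monic_X_pow_mul_sub hp t 4 (4 / 3)).1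

theorem natDegree_fiberPoly {L : Type*} [Field L] {p : ℕ} (hp : 3 < p) (t : L) :
    (fiberPoly p t).natDegree = p + 1 := (monic_X_pow_mul_sub hp t 4 (4 / 3)).2

theorem realizingPoly_monic (E : Type*) [Field E] {p : ℕ} (hp : 3 < p) :
    (realizingPoly E p).Monic := (monic_X_pow_mul_sub hp _ _ _).1

theorem natDegree_realizingPoly (E : Type*) [Field E] {p : ℕ} (hp : 3 < p) :
    (realizingPoly E p).natDegree = p + 1 := (monic_X_pow_mul_sub hp _ _ _).2

/-- The generic fibre has no rational point. -/
theorem eval_fiberPoly_X_ne_zero {E : Type*} [Field E] {p : ℕ} [Fact p.Prime] [CharP E p]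
    (hp : 3 < p) (z : RatFunc E) : (fiberPoly p (RatFunc.X : RatFunc E)).eval z ≠ 0 := by
  have h2 : (2 : E) ≠ 0 := two_ne_zero_of_charP hp
  have h3 : (3 : E) ≠ 0 := three_ne_zero_of_charP hp
  have h4 : (4 : E) ≠ 0 := by
    rw [show (4 : E) = 2 * 2 by norm_num]; exact mul_ne_zero h2 h2
  intro hz
  have hint : IsIntegral E[X] z := by
    refine ⟨realizingPoly E p, realizingPoly_monic E hp, ?_⟩
    rw [← eval_map, map_realizingPoly, RatFunc.algebraMap_X]
    exact hz
  obtain ⟨w, rfl⟩ := IsIntegrallyClosed.algebraMap_eq_of_integral hint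
  have hw : w ^ p * (w - 1) - X * ((w - C 4) ^ (p - 2) * (w - C (4 / 3)) ^ 2) = 0 := by
    apply IsFractionRing.injective E[X] (RatFunc E)
    rw [eval_fiberPoly] at hz
    have h (c : E) : algebraMap E[X] (RatFunc E) (C c) = algebraMap E (RatFunc E) c :=
      (IsScalarTower.algebraMap_apply E E[X] (RatFunc E) c).symm
    simp only [map_sub, map_mul, map_pow, map_one, map_zero, h, RatFunc.algebraMap_X, map_div₀,
      map_ofNat]
    rw [← hz, mul_assoc]
  have hcop (c : E) (hc : c ≠ 0) : IsCoprime w (w - C c) :=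
    ⟨C c⁻¹, -C c⁻¹, by
      have : C c⁻¹ * C c = (1 : E[X]) := by rw [← C_mul, inv_mul_cancel₀ hc, C_1]
      linear_combination this⟩
  -- `w` is coprime to `w - 4` and `w - 4/3`, so `w ^ p` divides `X` and `w` must be constant.
  have hdvd : w ^ p ∣ X := by
    have h5 : IsCoprime (w ^ p) ((w - C 4) ^ (p - 2) * (w - C (4 / 3)) ^ 2) :=
      .mul_right (hcop 4 h4).pow (hcop (4 / 3) (div_ne_zero h4 h3)).pow
    exact h5.dvd_of_dvd_mul_right ⟨w - 1, (sub_eq_zero.mp hw).symm⟩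
  have hdeg : w.natDegree = 0 := by
    have := natDegree_le_of_dvd hdvd X_ne_zero
    rw [natDegree_pow, natDegree_X] at this
    by_contra h
    have : p * 1 ≤ p * w.natDegree := Nat.mul_le_mul_left p (Nat.one_le_iff_ne_zero.mpr h)
    omega
  obtain ⟨c, rfl⟩ : ∃ c, w = C c := ⟨_, eq_C_of_natDegree_eq_zero hdeg⟩
  simp only [← C_1 (R := E), ← C_sub, ← C_pow, ← C_mul] at hw
  -- For `w = c` the coefficients in `X` say `c ∈ {0, 1}` and `c ∈ {4, 4/3}`, which are disjoint
  -- sets because `2` and `3` are nonzero.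
  have h0 := congrArg (coeff · 0) hw
  have h1 := congrArg (coeff · 1) hw
  simp only [coeff_sub, mul_comm X, coeff_C_mul, coeff_C_zero, coeff_X_zero, coeff_X_one,
    coeff_C_succ, coeff_zero, mul_zero, mul_one, sub_zero, zero_sub, neg_eq_zero, mul_eq_zero,
    pow_eq_zero_iff', sub_eq_zero] at h0 h1
  rcases h1 with ⟨h1, -⟩ | ⟨h1, -⟩ <;> rcases h0 with ⟨h0, -⟩ | h0
  · exact h4 (h1.symm.trans h0)
  · exact h3 (by linear_combination h1.symm.trans h0)
  · exact div_ne_zero h4 h3 (h1.symm.trans h0)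
  · have := h1.symm.trans h0
    rw [div_eq_one_iff_eq h3] at this
    exact one_ne_zero (α := E) (by linear_combination this)

end FiberPoly

/-! ### Criteria for geometric extensions and for realizations -/

theorem RatFunc.ringHom_ext_of_X {F L : Type*} [Field F] [Field L] {φ ψ : RatFunc F →+* L}
    (hC : ∀ c : F, φ (algebraMap F (RatFunc F) c) = ψ (algebraMap F (RatFunc F) c))
    (hX : φ RatFunc.X = ψ RatFunc.X) : φ = ψ := by
  refine IsLocalization.ringHom_ext (nonZeroDivisors F[X]) (Polynomial.ringHom_ext ?_ ?_)
  · intro c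
    simpa [← Polynomial.algebraMap_eq, ← IsScalarTower.algebraMap_apply] using hC c
  · simpa using hX

/-- For a constant `c` of `K` let `E = F(c)`, a finite field. `T` stays transcendental over `E`, so
`E(T)` lies between `F(T)` and `K`; equal degrees force `E(T) = F(T)`, which then contains `c`. -/
theorem isGeometricExtension_of_finrank_eq {F K : Type*} [Field F] [Finite F] [Field K]
    [Algebra F K] [Algebra (RatFunc F) K] [IsScalarTower F (RatFunc F) K]
    [FiniteDimensional (RatFunc F) K]
    (h : ∀ (E : IntermediateField F K) [Finite E] [Algebra (RatFunc E) K]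
      [IsScalarTower E (RatFunc E) K] [Algebra (RatFunc F) (RatFunc E)]
      [IsScalarTower (RatFunc F) (RatFunc E) K],
      algebraMap (RatFunc E) K RatFunc.X = algebraMap (RatFunc F) K RatFunc.X →
      Module.finrank (RatFunc E) K = Module.finrank (RatFunc F) K) :
    IsGeometricExtension F (RatFunc F) K := by
  refine le_antisymm (fun c hc ↦ ?_) ?_
  · rw [mem_algebraicClosure_iff] at hc
    let E := IntermediateField.adjoin F {c}
    have : FiniteDimensional F E := IntermediateField.adjoin.finiteDimensional hc.isIntegral
    have : Finite E := Module.finite_of_finite F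
    set t := algebraMap (RatFunc F) K RatFunc.X with ht
    have htF : Transcendental F t := by
      rw [ht, transcendental_algebraMap_iff (algebraMap (RatFunc F) K).injective]
      exact RatFunc.transcendental_X
    have htE : Transcendental E t := fun halg ↦ htF (halg.restrictScalars F)
    let φ : RatFunc E →ₐ[E] K := (IntermediateField.val _).comp
      (RatFunc.algEquivOfTranscendental t htE).toAlgHom
    let : Algebra (RatFunc E) K := φ.toRingHom.toAlgebra
    have : IsScalarTower E (RatFunc E) K := .of_algebraMap_eq fun x ↦ (φ.commutes x).symm
    have hφX : algebraMap (RatFunc E) K RatFunc.X = t := by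
      change φ RatFunc.X = t
      simp [φ]
    let ψ : RatFunc F →+* RatFunc E := IsLocalization.map (RatFunc E)
      (Polynomial.mapRingHom (algebraMap F E))
      (nonZeroDivisors_le_comap_nonZeroDivisors_of_injective _
        (Polynomial.map_injective _ (algebraMap F E).injective))
    let : Algebra (RatFunc F) (RatFunc E) := ψ.toAlgebra
    have hψ (f : F[X]) : ψ (algebraMap F[X] (RatFunc F) f) =
        algebraMap E[X] (RatFunc E) (f.map (algebraMap F E)) :=
      IsLocalization.map_eq _ f
    have hψX : ψ RatFunc.X = RatFunc.X := by
      simpa using hψ X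
    have hψC (c : F) : ψ (algebraMap F (RatFunc F) c) =
        algebraMap E (RatFunc E) (algebraMap F E c) := by
      have := hψ (C c)
      rwa [map_C, ← Polynomial.algebraMap_eq, ← Polynomial.algebraMap_eq,
        ← IsScalarTower.algebraMap_apply, ← IsScalarTower.algebraMap_apply] at this
    have : IsScalarTower (RatFunc F) (RatFunc E) K := by
      refine .of_algebraMap_eq' (RatFunc.ringHom_ext_of_X (fun c ↦ ?_) ?_)
      · change _ = algebraMap (RatFunc E) K (ψ _)
        rw [hψC, ← IsScalarTower.algebraMap_apply, ← IsScalarTower.algebraMap_apply,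
          ← IsScalarTower.algebraMap_apply]
      · change _ = algebraMap (RatFunc E) K (ψ _)
        rw [hψX, hφX]
    have hfin := h E hφX
    have : FiniteDimensional (RatFunc F) (RatFunc E) :=
      FiniteDimensional.left (RatFunc F) (RatFunc E) K
    have hmul := Module.finrank_mul_finrank (RatFunc F) (RatFunc E) K
    rw [hfin] at hmul
    have hone : Module.finrank (RatFunc F) (RatFunc E) = 1 :=
      Nat.eq_of_mul_eq_mul_right Module.finrank_pos (hmul.trans (one_mul _).symm)
    obtain ⟨x, hx⟩ := Algebra.mem_bot.mp <|
      (Subalgebra.bot_eq_top_iff_finrank_eq_one.mpr hone).ge <| Algebra.mem_top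
        (x := algebraMap E (RatFunc E) ⟨c, IntermediateField.mem_adjoin_simple_self F c⟩)
    have hxc : algebraMap (RatFunc F) K x = c := by
      rw [IsScalarTower.algebraMap_apply (RatFunc F) (RatFunc E) K, hx,
        ← IsScalarTower.algebraMap_apply]
      rfl
    refine ⟨x, ?_, hxc⟩
    change x ∈ algebraicClosure F (RatFunc F)
    rw [mem_algebraicClosure_iff]
    rw [← hxc] at hc
    exact (isAlgebraic_algebraMap_iff (algebraMap (RatFunc F) K).injective).mp hc
  · rintro _ ⟨x, hx, rfl⟩
    replace hx : IsAlgebraic F x := mem_algebraicClosure_iff.mp hx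
    rw [mem_algebraicClosure_iff]
    exact hx.algHom (IsScalarTower.toAlgHom F (RatFunc F) K)

/-- A Galois extension of `F(T)` is unramified outside `0` and `∞` and tame over `∞` if its inertia
groups are trivial resp. contain no element of order `p`. -/
theorem isLgt1Realization_of_inertia {p : ℕ} [Fact p.Prime] {F : Type*} [Field F] [Finite F]
    [CharP F p] {G : Type*} [Group G] {K : Type*} [Field K] [Algebra F K] [Algebra (RatFunc F) K]
    [IsScalarTower F (RatFunc F) K] [FiniteDimensional (RatFunc F) K] [IsGalois (RatFunc F) K]
    (e : (K ≃ₐ[RatFunc F] K) ≃* G) (hgeom : IsGeometricExtension F (RatFunc F) K)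
    (hunram : ∀ (Q : PrimeDivisor F K) (σ : K ≃ₐ[RatFunc F] K), Q.ring.IsInertial σ.toRingEquiv →
      Q.ring.valuation (algebraMap (RatFunc F) K RatFunc.X) = 1 → σ = 1)
    (htame : ∀ (Q : PrimeDivisor F K) (σ : K ≃ₐ[RatFunc F] K), Q.ring.IsInertial σ.toRingEquiv →
      1 < Q.ring.valuation (algebraMap (RatFunc F) K RatFunc.X) → σ ^ p = 1 → σ = 1) :
    IsLgt1Realization F G K := by
  obtain ⟨P₁, hP₁⟩ := PrimeDivisor.exists_valuation_lt_one F (θ := RatFunc.X) (.inl rfl)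
  obtain ⟨P₂, hP₂⟩ := PrimeDivisor.exists_valuation_lt_one F (θ := RatFunc.X⁻¹) (.inr rfl)
  have hlies {Q : PrimeDivisor F K} {P : PrimeDivisor F (RatFunc F)} (hQ : Q.LiesOver P)
      (x : RatFunc F) : P.ring.valuation x < 1 ↔
      Q.ring.valuation (algebraMap (RatFunc F) K x) < 1 := by
    rw [← PrimeDivisor.below_valuation_lt_one_iff]
    change _ ↔ (Q.ring.comap (algebraMap (RatFunc F) K)).valuation x < 1
    rw [hQ]
  refine ⟨inferInstance, ⟨e⟩, hgeom, P₁, P₂, ?_, P₁.degree_eq_one_of_valuation_lt_one (.inl rfl) hP₁,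
    P₂.degree_eq_one_of_valuation_lt_one (.inr rfl) hP₂, ?_, ?_⟩
  · rintro rfl
    rw [map_inv₀] at hP₂
    exact (one_lt_inv₀ (by simp [zero_lt_iff, RatFunc.X_ne_zero])).mpr hP₁ |>.not_gt hP₂
  · intro P h1 h2 Q hQ
    obtain ⟨I, hI, hI', -⟩ := Q.exists_inertia
    have hv : Q.ring.valuation (algebraMap (RatFunc F) K RatFunc.X) = 1 := by
      refine le_antisymm (not_lt.mp fun h ↦ h2 ?_) (not_lt.mp fun h ↦ h1 ?_)
      · refine PrimeDivisor.eq_of_valuation_lt_one (.inr rfl) ((hlies hQ _).mpr ?_) hP₂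
        rw [map_inv₀, map_inv₀]
        exact inv_lt_one_of_one_lt₀ h
      · exact PrimeDivisor.eq_of_valuation_lt_one (.inl rfl) ((hlies hQ _).mpr h) hP₁
    have hbot : I = ⊥ := (Subgroup.eq_bot_iff_forall I).mpr fun σ hσ ↦ hunram Q σ (hI' σ hσ) hv
    rw [← hI, hbot, Subgroup.card_bot]
  · intro Q hQ hdvd
    obtain ⟨I, hI, hI', -⟩ := Q.exists_inertia
    rw [ringChar.eq F p, ← hI] at hdvd
    -- Wild ramification would give, by Cauchy's theorem, an inertial element of order `p`.
    obtain ⟨⟨σ, hσI⟩, hσ⟩ := exists_prime_orderOf_dvd_card' p hdvd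
    rw [Subgroup.orderOf_mk] at hσ
    have hv : 1 < Q.ring.valuation (algebraMap (RatFunc F) K RatFunc.X) := by
      have := (hlies hQ _).mp hP₂
      rw [map_inv₀, map_inv₀] at this
      exact (inv_lt_one₀ (by simp [zero_lt_iff, RatFunc.X_ne_zero])).mp this
    have h1 := htame Q σ (hI' σ hσI) hv (by rw [← hσ, pow_orderOf_eq_one])
    rw [h1, orderOf_one] at hσ
    exact (Fact.out : p.Prime).one_lt.ne hσ

theorem map_fiberPoly {L M : Type*} [Field L] [Field M] (φ : L →+* M) (p : ℕ) (t : L) :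
    (fiberPoly p t).map φ = fiberPoly p (φ t) := by
  have h (c : L) (n : M) (hc : φ c = n) : (C c : L[X]).map φ = C n := by rw [map_C, hc]
  simp only [fiberPoly, Polynomial.map_sub, Polynomial.map_mul, Polynomial.map_pow, map_X,
    Polynomial.map_one, h t _ rfl, h 4 4 (map_ofNat φ 4), h (4 / 3) (4 / 3) (by rw [map_div₀, map_ofNat, map_ofNat])]

section SplittingField

variable {k K : Type*} [Field k] [Field K] [Algebra k K] {f : k[X]}

theorem Polynomial.eval_map_algEquiv_apply (σ : K ≃ₐ[k] K) {a : K}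
    (ha : (f.map (algebraMap k K)).eval a = 0) : (f.map (algebraMap k K)).eval (σ a) = 0 := by
  rw [eval_map_algebraMap] at ha ⊢
  rw [show σ a = (σ : K →ₐ[k] K) a from rfl, aeval_algHom_apply, ha, map_zero]

theorem Polynomial.IsSplittingField.algEquiv_eq_one [f.IsSplittingField k K] {σ : K ≃ₐ[k] K}
    (h : ∀ a, (f.map (algebraMap k K)).eval a = 0 → σ a = a) : σ = 1 := by
  refine IsSplittingField.toPermHom_injective (f := f) ?_
  rw [map_one]
  ext a
  refine h a ?_
  rw [eval_map_algebraMap]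
  exact aeval_eq_zero_of_mem_rootSet a.2

end SplittingField

/-! ### Inertia at infinity acting on the fibre -/

section Inertia

variable {K : Type*} [Field K] {V : ValuationSubring K} {σ : K ≃+* K} (hσ : V.IsInertial σ)
  {p : ℕ} (hp : 3 < p) {t : K} (h2 : V.valuation 2 = 1)
  (h3 : V.valuation 3 = 1) (ht : 1 < V.valuation t) {S : Finset K}
  (hS : ∀ z : K, ∏ a ∈ S, (z - a) = z ^ p * (z - 1) - t * (z - 4) ^ (p - 2) * (z - 4 / 3) ^ 2)
  (hσS : ∀ a ∈ S, σ a ∈ S) {a : K} (ha : a ∈ S)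

include hσ hp h2 h3 ht hS hσS ha in
-- `σ` maps poles to poles, and there is only one.
theorem ValuationSubring.IsInertial.apply_eq_of_pole (h : 1 < V.valuation a) : σ a = a := by
  classical
  obtain ⟨b, hb⟩ := Finset.card_eq_one.mp (Valuation.card_filter_pole V.valuation hp h2 h3 ht hS)
  have h1 : a ∈ S.filter (fun a ↦ 1 < V.valuation a) := by simp [ha, h]
  have h2 : σ a ∈ S.filter (fun a ↦ 1 < V.valuation a) := by simp [hσS a ha, hσ.one_lt_map h]
  simp only [hb, Finset.mem_singleton] at h1 h2
  rw [h2, h1]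

include hσ in
theorem ValuationSubring.IsInertial.map_near (h : V.valuation (a - 4 / 3) < 1) :
    V.valuation (σ a - 4 / 3) < 1 := by
  have := hσ.map_lt_one h
  rwa [map_sub, map_div₀, map_ofNat, map_ofNat] at this

include hp h2 h3 ht hS in
theorem ValuationSubring.exists_near_pair : ∃ b ∈ S, ∃ c ∈ S, b ≠ c ∧
    V.valuation (b - 4 / 3) < 1 ∧ V.valuation (c - 4 / 3) < 1 ∧
    ∀ a ∈ S, V.valuation (a - 4 / 3) < 1 → a = b ∨ a = c := by
  classical
  obtain ⟨b, c, hbc, h⟩ :=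
    Finset.card_eq_two.mp (Valuation.card_filter_near V.valuation hp h2 h3 ht hS)
  simp only [Finset.ext_iff, Finset.mem_filter, Finset.mem_insert, Finset.mem_singleton] at h
  obtain ⟨hb, hb'⟩ := (h b).mpr (.inl rfl)
  obtain ⟨hc, hc'⟩ := (h c).mpr (.inr rfl)
  exact ⟨b, hb, c, hc, hbc, hb', hc', fun a ha ha' ↦ (h a).mp ⟨ha, ha'⟩⟩

include hσ hp h2 h3 ht hS hσS ha in
-- `σ` permutes the two roots near `4 / 3`, so its square fixes them.
theorem ValuationSubring.IsInertial.apply_apply_of_near (h : V.valuation (a - 4 / 3) < 1) :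
    σ (σ a) = a := by
  obtain ⟨b, hb, c, hc, hbc, hb', hc', huniq⟩ := V.exists_near_pair hp h2 h3 ht hS
  have h' := hσ.map_near h
  have h1 := huniq a ha h
  have h2 := huniq _ (hσS a ha) h'
  have h3 := huniq _ (hσS _ (hσS a ha)) (hσ.map_near h')
  have h4 (h : σ (σ a) = σ a) : σ a = a := σ.injective h
  grind

include hσ hp h2 h3 ht hS hσS ha in
/-- An involution in the inertia group at infinity can only move the two roots near `4 / 3`. -/
theorem ValuationSubring.IsInertial.apply_eq_of_not_near [Fact p.Prime] [CharP K p]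
    (h : ¬ V.valuation (a - 4 / 3) < 1) (hinv : σ (σ a) = a) : σ a = a := by
  have heval {a : K} (ha : a ∈ S) : (fiberPoly p t).eval a = 0 := by
    rw [eval_fiberPoly, ← hS, Finset.prod_eq_zero ha (sub_self a)]
  rcases V.valuation.root_trichotomy hp h2 h3 ht (root_eq_of_prod_eq hS ha) with h' | h' | h'
  · exact hσ.apply_eq_of_pole hp h2 h3 ht hS hσS ha h'.1
  · exact hσ.apply_eq_of_near_four hp h2 h3 ht (heval ha) (heval (hσS a ha)) h'.2.1 hinv
  · exact absurd h'.2.2.1 h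

end Inertia

/-- By the derivative identity a multiple root would be `0`, where the polynomial is a nonzero
constant times `T`. -/
theorem fiberPoly_X_separable (E : Type*) [Field E] {p : ℕ} [Fact p.Prime] [CharP E p]
    (hp : 3 < p) : (fiberPoly p (RatFunc.X : RatFunc E)).Separable := by
  let K := (fiberPoly p (RatFunc.X : RatFunc E)).SplittingField
  have : CharP (RatFunc E) p := charP_of_injective_algebraMap (algebraMap E (RatFunc E)).injective p
  have : CharP K p := charP_of_injective_algebraMap (algebraMap (RatFunc E) K).injective p
  refine Polynomial.Separable.of_forall_derivative_ne_zero (K := K) (fiberPoly_monic hp _).ne_zero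
    fun a ha ha' ↦ ?_
  rw [map_fiberPoly] at ha ha'
  have h := eval_derivative_fiberPoly hp ha
  rw [ha', zero_mul] at h
  obtain rfl : a = 0 := eq_zero_of_pow_eq_zero h.symm
  have h2 : (2 : K) ≠ 0 := two_ne_zero_of_charP hp
  have h3 : (3 : K) ≠ 0 := three_ne_zero_of_charP hp
  have h4 : (4 : K) ≠ 0 := by
    rw [show (4 : K) = 2 * 2 by norm_num]; exact mul_ne_zero h2 h2
  rw [eval_fiberPoly, zero_pow (by omega)] at ha
  have ht : algebraMap (RatFunc E) K RatFunc.X ≠ 0 := by simp [RatFunc.X_ne_zero]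
  simp [h4, h3, ht] at ha

theorem PrimeDivisor.valuation_two_and_three {E : Type*} (K : Type*) [Field E] [Field K]
    [Algebra E K] {p : ℕ} [Fact p.Prime] [CharP E p] (hp : 3 < p) (Q : PrimeDivisor E K) :
    Q.ring.valuation 2 = 1 ∧ Q.ring.valuation 3 = 1 :=
  ⟨Q.valuation_eq_one_of_algebraMap_eq (two_ne_zero_of_charP hp) (map_ofNat _ 2),
    Q.valuation_eq_one_of_algebraMap_eq (three_ne_zero_of_charP hp) (map_ofNat _ 3)⟩

theorem apply_mem_toFinset_rootSet {k K : Type*} [Field k] [Field K] [Algebra k K] {f : k[X]}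
    (σ : K ≃ₐ[k] K) (a : K) (ha : a ∈ (f.rootSet K).toFinset) : σ a ∈ (f.rootSet K).toFinset := by
  rw [Set.mem_toFinset] at ha ⊢
  exact (σ • (⟨a, ha⟩ : f.rootSet K)).2

/-! ### The Galois group is `S_{p+1}` -/

section GaloisGroup

variable {E K : Type*} [Field E] [Field K] [Algebra (RatFunc E) K] {p : ℕ} [Fact p.Prime] [CharP E p] (hp : 3 < p)
  [(fiberPoly p (RatFunc.X : RatFunc E)).IsSplittingField (RatFunc E) K]

include hp in
theorem prod_rootSet_fiberPoly_X (z : K) :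
    ∏ a ∈ ((fiberPoly p (RatFunc.X : RatFunc E)).rootSet K).toFinset, (z - a) =
      z ^ p * (z - 1) - algebraMap (RatFunc E) K RatFunc.X * (z - 4) ^ (p - 2) * (z - 4 / 3) ^ 2 := by
  rw [prod_rootSet_sub (fiberPoly_monic hp _) (fiberPoly_X_separable E hp), map_fiberPoly,
    eval_fiberPoly]

include hp in
theorem card_rootSet_fiberPoly_X :
    Fintype.card ((fiberPoly p (RatFunc.X : RatFunc E)).rootSet K) = p + 1 := by
  rw [card_rootSet_eq_natDegree (fiberPoly_X_separable E hp) (IsSplittingField.splits K _),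
    natDegree_fiberPoly hp]

variable [Algebra E K]

include hp in
/-- The extension is unramified outside `0` and `∞`. -/
theorem eq_one_of_isInertial_of_map_eq_one {Q : PrimeDivisor E K} {σ : K ≃ₐ[RatFunc E] K}
    (hσ : Q.ring.IsInertial σ.toRingEquiv) (ht : Q.ring.valuation (algebraMap (RatFunc E) K RatFunc.X) = 1) : σ = 1 := by
  have : CharP K p := charP_of_injective_algebraMap (algebraMap E K).injective p
  obtain ⟨h2, h3⟩ := Q.valuation_two_and_three K hp
  refine Polynomial.IsSplittingField.algEquiv_eq_one (f := fiberPoly p (RatFunc.X : RatFunc E))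
    fun a ha ↦ ?_
  have hb := eval_map_algEquiv_apply σ ha
  rw [map_fiberPoly] at ha hb
  refine (Q.ring.root_eq_of_map_eq_one hp h2 h3 ht ha hb (hσ a ?_)).symm
  rw [eval_fiberPoly] at ha
  exact (Q.ring.valuation.root_of_map_eq_one hp h2 h3 ht
    (by linear_combination ha)).1.le

include hp in
/-- The inertia groups over `∞` contain no elements of order `p`. -/
theorem eq_one_of_isInertial_of_pow_eq_one {Q : PrimeDivisor E K} {σ : K ≃ₐ[RatFunc E] K}
    (hσ : Q.ring.IsInertial σ.toRingEquiv) (ht : 1 < Q.ring.valuation (algebraMap (RatFunc E) K RatFunc.X)) (hσp : σ ^ p = 1) :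
    σ = 1 := by
  classical
  set f := fiberPoly p (RatFunc.X : RatFunc E) with hf
  obtain ⟨h2, h3⟩ := Q.valuation_two_and_three K hp
  have hS := prod_rootSet_fiberPoly_X (E := E) (K := K) hp
  have hσS := apply_mem_toFinset_rootSet (f := f) σ
  obtain ⟨b, hb, c, hc, hbc, hb', hc', -⟩ := Q.ring.exists_near_pair hp h2 h3 ht hS
  obtain ⟨a, ha⟩ := Finset.card_eq_one.mp
    (Valuation.card_filter_pole Q.ring.valuation hp h2 h3 ht hS)
  obtain ⟨ha, ha'⟩ := Finset.mem_filter.mp (ha.ge (Finset.mem_singleton_self a))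
  have hodd : Odd p := (Fact.out : p.Prime).eq_two_or_odd'.resolve_left (by omega)
  -- Both `σ ^ 2` and `σ ^ p` fix `x`, and `p` is odd.
  have hnear (x : K) (hx : x ∈ (f.rootSet K).toFinset)
      (hx' : Q.ring.valuation (x - 4 / 3) < 1) : σ x = x := by
    have h : σ (σ x) = x := hσ.apply_apply_of_near hp h2 h3 ht hS hσS hx hx'
    obtain ⟨m, hm⟩ := hodd
    have h1 : (σ ^ 2) x = x := h
    have h2 : ((σ ^ 2) ^ m) x = x := by
      clear hm
      induction m with
      | zero => rfl
      | succ m ih => rw [pow_succ, AlgEquiv.mul_apply, h1, ih]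
    have h3 : (σ ^ p) x = x := by rw [hσp]; rfl
    rw [hm, pow_succ', pow_mul, AlgEquiv.mul_apply, h2] at h3
    exact h3
  have hpole : σ a = a := hσ.apply_eq_of_pole hp h2 h3 ht hS hσS ha ha'
  refine IsSplittingField.toPermHom_injective (f := f) ?_
  rw [map_one]
  by_contra hne
  set τ := MulAction.toPermHom (K ≃ₐ[RatFunc E] K) (f.rootSet K) σ with hτ
  have hord : orderOf τ = p := orderOf_eq_prime (by rw [hτ, ← map_pow, hσp, map_one]) hne
  have hcard : Fintype.card (f.rootSet K) = p + 1 := card_rootSet_fiberPoly_X hp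
  -- A nontrivial `τ` would be a `p`-cycle with a single fixed point, but the pole `a` and the root
  -- `b` near `4 / 3` are two.
  have hcyc : τ.IsCycle := Equiv.Perm.isCycle_of_prime_order' (hord ▸ Fact.out)
    (by rw [hord, hcard]; omega)
  have hsupp : τ.support.card = p := by rw [← hcyc.orderOf, hord]
  have hca : a ≠ b := by
    rintro rfl
    rcases Q.ring.valuation.root_trichotomy hp h2 h3 ht (root_eq_of_prod_eq hS ha) with h | h | h
    · have := Valuation.map_sub_eq_of_one_lt Q.ring.valuation h.1
        ((Q.ring.valuation.map_branch_points h2 h3).2.1.le)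
      rw [this] at hb'
      exact hb'.not_gt h.1
    · exact ha'.ne' h.1
    · exact ha'.ne' h.1
  rw [Set.mem_toFinset] at ha hb
  have hab : ({⟨a, ha⟩, ⟨b, hb⟩} : Finset (f.rootSet K)) ⊆ τ.supportᶜ := by
    intro x hx
    rw [Finset.mem_compl, Equiv.Perm.notMem_support]
    simp only [Finset.mem_insert, Finset.mem_singleton] at hx
    rcases hx with rfl | rfl
    · exact Subtype.ext hpole
    · exact Subtype.ext (hnear b (by simpa using hb) hb')
  have := Finset.card_le_card hab
  rw [Finset.card_compl, hsupp, hcard, Finset.card_pair (by simpa using hca)] at this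
  omega

end GaloisGroup

theorem AlgEquiv.exists_apply_ne_of_notMem_range {k K : Type*} [Field k] [Field K] [Algebra k K]
    [FiniteDimensional k K] [IsGalois k K] {a : K} (ha : a ∉ (algebraMap k K).range) :
    ∃ σ : K ≃ₐ[k] K, σ a ≠ a := by
  by_contra! h
  exact ha (IntermediateField.mem_bot.mp ((IsGalois.mem_bot_iff_fixed a).mpr h))

theorem exists_perm_fiberPoly_X_ne {E : Type*} (K : Type*) [Field E] [Field K] [Algebra (RatFunc E) K]
    {p : ℕ} [Fact p.Prime] [CharP E p] (hp : 3 < p) [FiniteDimensional (RatFunc E) K]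
    [IsGalois (RatFunc E) K]
    (z : (fiberPoly p (RatFunc.X : RatFunc E)).rootSet K) :
    ∃ g ∈ (MulAction.toPermHom (K ≃ₐ[RatFunc E] K)
      ((fiberPoly p (RatFunc.X : RatFunc E)).rootSet K)).range, g z ≠ z := by
  have hz : (z : K) ∉ (algebraMap (RatFunc E) K).range := by
    rintro ⟨w, hw⟩
    refine eval_fiberPoly_X_ne_zero hp w ((algebraMap (RatFunc E) K).injective ?_)
    rw [map_zero, ← eval_map_apply, hw, eval_map_algebraMap]
    exact aeval_eq_zero_of_mem_rootSet z.2
  obtain ⟨σ, hσ⟩ := AlgEquiv.exists_apply_ne_of_notMem_range hz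
  exact ⟨_, ⟨σ, rfl⟩, fun h ↦ hσ (congrArg Subtype.val h)⟩

section GaloisGroup

variable {E : Type*} (K : Type*) [Field E] [Field K] [Algebra (RatFunc E) K] {p : ℕ}
  [Fact p.Prime] [CharP E p] (hp : 3 < p)
  [(fiberPoly p (RatFunc.X : RatFunc E)).IsSplittingField (RatFunc E) K]

include hp in
theorem isGalois_of_isSplittingField_fiberPoly_X :
    FiniteDimensional (RatFunc E) K ∧ IsGalois (RatFunc E) K :=
  ⟨IsSplittingField.finiteDimensional K (fiberPoly p (RatFunc.X : RatFunc E)),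
    IsGalois.of_separable_splitting_field (fiberPoly_X_separable E hp)⟩

variable [Finite E] [Algebra E K] [IsScalarTower E (RatFunc E) K]

include hp in
theorem dvd_card_algEquiv_fiberPoly_X [FiniteDimensional (RatFunc E) K] [IsGalois (RatFunc E) K] :
    p ∣ Nat.card (K ≃ₐ[RatFunc E] K) := by
  obtain ⟨Q, I, hlt, -, hI⟩ := PrimeDivisor.exists_inertia_of_generator K
    (θ := (RatFunc.X : RatFunc E)) (.inl rfl)
  obtain ⟨h2, h3⟩ := Q.valuation_two_and_three K hp
  obtain ⟨a, -, ha⟩ := Q.ring.valuation.exists_root_lt_one hp h2 h3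
    (prod_rootSet_fiberPoly_X (E := E) (K := K) hp) hlt
  exact (hI a p ha).trans I.card_subgroup_dvd_card

open Classical in
include hp in
-- A root near `4 / 3` forces even ramification over `∞`, hence an involution in inertia. It fixes
-- every other kind of root, so, being nontrivial, it must swap the two near `4 / 3`.
theorem exists_isSwap_fiberPoly_X [FiniteDimensional (RatFunc E) K] [IsGalois (RatFunc E) K] :
    ∃ τ ∈ (MulAction.toPermHom (K ≃ₐ[RatFunc E] K)
      ((fiberPoly p (RatFunc.X : RatFunc E)).rootSet K)).range, τ.IsSwap := by
  set f := fiberPoly p (RatFunc.X : RatFunc E) with hf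
  have : CharP K p := charP_of_injective_algebraMap (algebraMap E K).injective p
  obtain ⟨Q, I, hlt, hI, hdvd⟩ := PrimeDivisor.exists_inertia_of_generator K
    (θ := (RatFunc.X : RatFunc E)⁻¹) (.inr rfl)
  obtain ⟨h2, h3⟩ := Q.valuation_two_and_three K hp
  have ht : 1 < Q.ring.valuation (algebraMap (RatFunc E) K RatFunc.X) := by
    rw [map_inv₀, map_inv₀] at hlt
    exact (inv_lt_one₀ (by simp [zero_lt_iff, RatFunc.X_ne_zero])).mp hlt
  have hS := prod_rootSet_fiberPoly_X (E := E) (K := K) hp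
  obtain ⟨b, hb, c, hc, hbc, hb', hc', huniq⟩ := Q.ring.exists_near_pair hp h2 h3 ht hS
  have hval : Q.ring.valuation (algebraMap (RatFunc E) K RatFunc.X⁻¹) =
      Q.ring.valuation (b - 4 / 3) ^ 2 := by
    rcases Q.ring.valuation.root_trichotomy hp h2 h3 ht (root_eq_of_prod_eq hS hb) with h | h | h
    · have := Valuation.map_sub_eq_of_one_lt Q.ring.valuation h.1
        ((Q.ring.valuation.map_branch_points h2 h3).2.1.le)
      rw [this] at hb'
      exact absurd h.1 hb'.not_gt
    · exact absurd h.2.2.1 hb'.ne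
    · rw [map_inv₀, map_inv₀]
      exact (eq_inv_of_mul_eq_one_left h.2.2.2).symm
  obtain ⟨⟨σ, hσI⟩, hσ⟩ := exists_prime_orderOf_dvd_card' 2 (hdvd _ 2 hval)
  rw [Subgroup.orderOf_mk] at hσ
  have hσ2 (x : K) : σ (σ x) = x := by
    have := pow_orderOf_eq_one σ
    rw [hσ, pow_two] at this
    exact DFunLike.congr_fun this x
  have hσS := apply_mem_toFinset_rootSet (f := f) σ
  have hfix (x : K) (hx : x ∈ (f.rootSet K).toFinset) (hxb : x ≠ b) (hxc : x ≠ c) : σ x = x :=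
    (hI σ hσI).apply_eq_of_not_near hp h2 h3 ht hS hσS hx
      (fun h ↦ (huniq x hx h).elim hxb hxc) (hσ2 x)
  have hσb : σ b = c := by
    refine (huniq _ (hσS b hb) ((hI σ hσI).map_near hb')).resolve_left fun h ↦ ?_
    have hσc : σ c = c := by
      refine (huniq _ (hσS c hc) ((hI σ hσI).map_near hc')).resolve_left fun h' ↦ hbc ?_
      exact σ.injective (h.trans h'.symm)
    have h1 : σ = 1 := by
      refine IsSplittingField.toPermHom_injective (f := f) ?_
      rw [map_one]
      ext x
      change σ x = x
      by_cases hxb : (x : K) = b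
      · rw [hxb, h]
      by_cases hxc : (x : K) = c
      · rw [hxc, hσc]
      exact hfix x (by simp) hxb hxc
    rw [h1, orderOf_one] at hσ
    exact absurd hσ (by norm_num)
  have hσc : σ c = b := by rw [← hσb, hσ2]
  rw [Set.mem_toFinset] at hb hc
  refine ⟨_, ⟨σ, rfl⟩, ⟨b, hb⟩, ⟨c, hc⟩, by simpa using hbc, ?_⟩
  ext x
  change σ x = _
  rcases eq_or_ne x ⟨b, hb⟩ with rfl | hxb
  · rw [Equiv.swap_apply_left, hσb]
  rcases eq_or_ne x ⟨c, hc⟩ with rfl | hxc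
  · rw [Equiv.swap_apply_right, hσc]
  rw [Equiv.swap_apply_of_ne_of_ne hxb hxc]
  exact hfix x (by simp) (fun h ↦ hxb (Subtype.ext h)) (fun h ↦ hxc (Subtype.ext h))

include hp in
theorem nonempty_algEquiv_mulEquiv_perm :
    Nonempty ((K ≃ₐ[RatFunc E] K) ≃* Equiv.Perm (Fin (p + 1))) := by
  classical
  obtain ⟨_, _⟩ := isGalois_of_isSplittingField_fiberPoly_X K hp (E := E)
  set f := fiberPoly p (RatFunc.X : RatFunc E) with hf
  have hinj := IsSplittingField.toPermHom_injective (f := f) (K := K)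
  have hcard : Fintype.card (f.rootSet K) = p + 1 := card_rootSet_fiberPoly_X hp
  have htop := Subgroup.eq_top_of_prime_dvd_of_isSwap_mem hcard
    (MulAction.toPermHom (K ≃ₐ[RatFunc E] K) (f.rootSet K)).range
    ((Nat.card_congr (MonoidHom.ofInjective hinj).toEquiv) ▸ dvd_card_algEquiv_fiberPoly_X K hp)
    (exists_isSwap_fiberPoly_X K hp) (exists_perm_fiberPoly_X_ne K hp)
  exact ⟨(MulEquiv.ofBijective _ ⟨hinj, MonoidHom.range_eq_top.mp htop⟩).trans
    (Fintype.equivFinOfCardEq hcard).permCongrHom⟩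

include hp in
theorem finrank_of_isSplittingField_fiberPoly_X :
    Module.finrank (RatFunc E) K = (p + 1).factorial := by
  obtain ⟨_, _⟩ := isGalois_of_isSplittingField_fiberPoly_X K hp (E := E)
  obtain ⟨e⟩ := nonempty_algEquiv_mulEquiv_perm K hp (E := E)
  rw [← IsGalois.card_aut_eq_finrank, Nat.card_congr e.toEquiv, Nat.card_eq_fintype_card,
    Fintype.card_perm, Fintype.card_fin]

end GaloisGroup

/-- Splitting fields are stable under base change inside the splitting field. -/
theorem Polynomial.IsSplittingField.of_map_eq {k l K : Type*} [Field k] [Field l] [Field K]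
    [Algebra k K] [Algebra l K] [Algebra k l] [IsScalarTower k l K] {f : k[X]} {g : l[X]}
    [hf : f.IsSplittingField k K] (h : f.map (algebraMap k K) = g.map (algebraMap l K)) :
    g.IsSplittingField l K := by
  refine ⟨h ▸ IsSplittingField.splits K f, ?_⟩
  have hroot : g.rootSet K = f.rootSet K := by
    classical
    rw [rootSet_def, rootSet_def, aroots_def, aroots_def, h]
  rw [hroot, eq_top_iff]
  intro x _
  have hx : x ∈ Algebra.adjoin k (f.rootSet K) := by
    rw [IsSplittingField.adjoin_rootSet]; exact Algebra.mem_top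
  have := Algebra.adjoin_le (S := (Algebra.adjoin l (f.rootSet K)).restrictScalars k)
    (fun y hy ↦ Algebra.subset_adjoin hy : f.rootSet K ⊆ _) hx
  exact this

theorem isLgt1Realization_of_isSplittingField_fiberPoly_X {E K : Type*} [Field E] [Finite E]
    [Field K] [Algebra E K] [Algebra (RatFunc E) K] [IsScalarTower E (RatFunc E) K] {p : ℕ}
    [Fact p.Prime] [CharP E p] (hp : 3 < p)
    [(fiberPoly p (RatFunc.X : RatFunc E)).IsSplittingField (RatFunc E) K] :
    IsLgt1Realization E (Equiv.Perm (Fin (p + 1))) K := by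
  obtain ⟨_, _⟩ := isGalois_of_isSplittingField_fiberPoly_X K hp (E := E)
  obtain ⟨e⟩ := nonempty_algEquiv_mulEquiv_perm K hp (E := E)
  refine isLgt1Realization_of_inertia (p := p) e (isGeometricExtension_of_finrank_eq ?_)
    (fun Q σ hσ ht ↦ eq_one_of_isInertial_of_map_eq_one hp hσ ht)
    (fun Q σ hσ ht hσp ↦ eq_one_of_isInertial_of_pow_eq_one hp hσ ht hσp)
  -- `K` is also the splitting field of the fibre polynomial over `L(T)`, so its degree there is
  -- again `(p + 1)!`.
  intro L _ _ _ _ _ hX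
  have : CharP L p := charP_of_injective_algebraMap (algebraMap E L).injective p
  have : (fiberPoly p (RatFunc.X : RatFunc L)).IsSplittingField (RatFunc L) K :=
    IsSplittingField.of_map_eq (k := RatFunc E) (f := fiberPoly p (RatFunc.X : RatFunc E))
      (by rw [map_fiberPoly, map_fiberPoly, hX])
  rw [finrank_of_isSplittingField_fiberPoly_X K hp (E := E),
    finrank_of_isSplittingField_fiberPoly_X K hp (E := L)]

/-! ### The Galois group of the quartic -/

section CharThree

/-- The polynomial `X ^ 4 + X + t`. -/
noncomputable def quarticPoly {L : Type*} [Field L] (t : L) : L[X] := X ^ 4 + X + C t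

theorem eval_quarticPoly {L : Type*} [Field L] (t z : L) :
    (quarticPoly t).eval z = z ^ 4 + z + t := by
  simp [quarticPoly]

theorem map_quarticPoly {L M : Type*} [Field L] [Field M] (φ : L →+* M) (t : L) :
    (quarticPoly t).map φ = quarticPoly (φ t) := by
  simp [quarticPoly]

theorem map_realizingPolyThree {E L : Type*} [Field E] [Field L] (φ : E[X] →+* L) :
    (realizingPolyThree E).map φ = quarticPoly (φ X) := by
  simp [quarticPoly, realizingPolyThree]

theorem quarticPoly_monic {L : Type*} [Field L] (t : L) : (quarticPoly t).Monic := by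
  unfold quarticPoly; monicity!

theorem natDegree_quarticPoly {L : Type*} [Field L] (t : L) : (quarticPoly t).natDegree = 4 := by
  unfold quarticPoly; compute_degree!

theorem quarticPoly_X_separable (E : Type*) [Field E] [CharP E 3] :
    (quarticPoly (RatFunc.X : RatFunc E)).Separable := by
  let K := (quarticPoly (RatFunc.X : RatFunc E)).SplittingField
  have : CharP (RatFunc E) 3 := charP_of_injective_algebraMap (algebraMap E (RatFunc E)).injective 3
  have : CharP K 3 := charP_of_injective_algebraMap (algebraMap (RatFunc E) K).injective 3
  refine Polynomial.Separable.of_forall_derivative_ne_zero (K := K) (quarticPoly_monic _).ne_zero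
    fun a ha ha' ↦ ?_
  rw [map_quarticPoly] at ha ha'
  replace ha' := (eval_derivative_quartic a).symm.trans ha'
  rw [eval_quarticPoly, eq_neg_of_add_eq_zero_left (eq_zero_of_pow_eq_zero ha')] at ha
  have ht : algebraMap (RatFunc E) K RatFunc.X ≠ 0 := by simp [RatFunc.X_ne_zero]
  exact ht (by linear_combination ha)

theorem eq_one_of_isInertial_of_map_eq_one_of_char_three {E K : Type*} [Field E] [Field K]
    [Algebra (RatFunc E) K] [Algebra E K] [CharP K 3]
    [(quarticPoly (RatFunc.X : RatFunc E)).IsSplittingField (RatFunc E) K] {Q : PrimeDivisor E K}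
    {σ : K ≃ₐ[RatFunc E] K} (hσ : Q.ring.IsInertial σ.toRingEquiv)
    (ht : Q.ring.valuation (algebraMap (RatFunc E) K RatFunc.X) = 1) : σ = 1 := by
  refine Polynomial.IsSplittingField.algEquiv_eq_one (f := quarticPoly (RatFunc.X : RatFunc E))
    fun a ha ↦ ?_
  have hb := eval_map_algEquiv_apply σ ha
  rw [map_quarticPoly, eval_quarticPoly] at ha hb
  exact (Q.ring.root_quartic_eq_of_map_eq_one ht ha hb
    (hσ a (Q.ring.valuation.root_quartic_of_map_eq_one ht ha).1.le)).symm

variable {E K : Type*} [Field E] [Field K] [Algebra (RatFunc E) K]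

theorem root_quarticPoly_X
    (a : (quarticPoly (RatFunc.X : RatFunc E)).rootSet K) :
    (a : K) ^ 4 + a + algebraMap (RatFunc E) K RatFunc.X = 0 := by
  have := aeval_eq_zero_of_mem_rootSet a.2
  rwa [← eval_map_algebraMap, map_quarticPoly, eval_quarticPoly] at this

theorem root_apply_quarticPoly_X (σ : K ≃ₐ[RatFunc E] K)
    (a : (quarticPoly (RatFunc.X : RatFunc E)).rootSet K) :
    σ a ^ 4 + σ a + algebraMap (RatFunc E) K RatFunc.X = 0 :=
  root_quarticPoly_X (σ • a)

/-- The inertia groups over `∞` act freely on the roots. -/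
theorem eq_one_of_isInertial_of_smul_eq {E K : Type*} [Field E] [Field K] [Algebra (RatFunc E) K] [Algebra E K]
    [CharP K 3] [(quarticPoly (RatFunc.X : RatFunc E)).IsSplittingField (RatFunc E) K] {Q : PrimeDivisor E K}
    {σ : K ≃ₐ[RatFunc E] K} (hσ : Q.ring.IsInertial σ.toRingEquiv)
    (ht : 1 < Q.ring.valuation (algebraMap (RatFunc E) K RatFunc.X))
    {a : (quarticPoly (RatFunc.X : RatFunc E)).rootSet K} (h : σ • a = a) : σ = 1 := by
  refine IsSplittingField.toPermHom_injective (f := quarticPoly (RatFunc.X : RatFunc E)) ?_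
  rw [map_one]
  ext b
  exact hσ.apply_eq_of_apply_eq ht (root_quarticPoly_X a) (root_quarticPoly_X b)
    (root_apply_quarticPoly_X σ b) (congrArg Subtype.val h)

variable [CharP E 3]
  [(quarticPoly (RatFunc.X : RatFunc E)).IsSplittingField (RatFunc E) K]

theorem prod_rootSet_quarticPoly_X (z : K) :
    ∏ a ∈ ((quarticPoly (RatFunc.X : RatFunc E)).rootSet K).toFinset, (z - a) =
      z ^ 4 + z + algebraMap (RatFunc E) K RatFunc.X := by
  rw [prod_rootSet_sub (quarticPoly_monic _) (quarticPoly_X_separable E), map_quarticPoly,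
    eval_quarticPoly]

theorem card_rootSet_quarticPoly_X :
    Fintype.card ((quarticPoly (RatFunc.X : RatFunc E)).rootSet K) = 4 := by
  rw [card_rootSet_eq_natDegree (quarticPoly_X_separable E) (IsSplittingField.splits K _),
    natDegree_quarticPoly]

variable (E K) in
theorem isGalois_of_isSplittingField_quarticPoly_X :
    FiniteDimensional (RatFunc E) K ∧ IsGalois (RatFunc E) K :=
  ⟨IsSplittingField.finiteDimensional K (quarticPoly (RatFunc.X : RatFunc E)),
    IsGalois.of_separable_splitting_field (quarticPoly_X_separable E)⟩

variable [Algebra E K]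

/-- A permutation of four roots with trivial cube has a fixed point, and inertia over `∞` acts
freely. -/
theorem eq_one_of_isInertial_of_pow_three_eq_one [CharP K 3] {Q : PrimeDivisor E K}
    {σ : K ≃ₐ[RatFunc E] K} (hσ : Q.ring.IsInertial σ.toRingEquiv)
    (ht : 1 < Q.ring.valuation (algebraMap (RatFunc E) K RatFunc.X)) (hσ3 : σ ^ 3 = 1) :
    σ = 1 := by
  classical
  set f := quarticPoly (RatFunc.X : RatFunc E)
  set τ := MulAction.toPermHom (K ≃ₐ[RatFunc E] K) (f.rootSet K) σ with hτ
  have hτ3 : τ ^ 3 = 1 := by rw [hτ, ← map_pow, hσ3, map_one]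
  obtain ⟨a, ha⟩ := Equiv.Perm.exists_fixed_point_of_prime (p := 3) (n := 1) (σ := τ)
    (by rw [card_rootSet_quarticPoly_X]; norm_num) (by simpa using hτ3)
  exact eq_one_of_isInertial_of_smul_eq hσ ht ha

variable [Finite E] [IsScalarTower E (RatFunc E) K] [FiniteDimensional (RatFunc E) K]
  [IsGalois (RatFunc E) K]

variable (E K) in
theorem three_dvd_card_algEquiv : 3 ∣ Nat.card (K ≃ₐ[RatFunc E] K) := by
  have : CharP K 3 := charP_of_injective_algebraMap (algebraMap E K).injective 3
  obtain ⟨Q, I, hlt, -, hI⟩ := PrimeDivisor.exists_inertia_of_generator K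
    (θ := (RatFunc.X : RatFunc E)) (.inl rfl)
  obtain ⟨a, -, ha⟩ := Q.ring.valuation.exists_root_quartic_lt_one
    (prod_rootSet_quarticPoly_X (E := E) (K := K)) hlt
  exact (hI _ 3 ha).trans I.card_subgroup_dvd_card

variable (E K) in
theorem four_dvd_card_algEquiv_and_exists_sign [DecidableEq K] :
    4 ∣ Nat.card (K ≃ₐ[RatFunc E] K) ∧
    ∃ τ ∈ (MulAction.toPermHom (K ≃ₐ[RatFunc E] K)
      ((quarticPoly (RatFunc.X : RatFunc E)).rootSet K)).range, Equiv.Perm.sign τ = -1 := by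
  set f := quarticPoly (RatFunc.X : RatFunc E)
  have : CharP K 3 := charP_of_injective_algebraMap (algebraMap E K).injective 3
  obtain ⟨Q, I, hlt, hI, hdvd⟩ := PrimeDivisor.exists_inertia_of_generator K
    (θ := (RatFunc.X : RatFunc E)⁻¹) (.inr rfl)
  have ht : 1 < Q.ring.valuation (algebraMap (RatFunc E) K RatFunc.X) := by
    rw [map_inv₀, map_inv₀] at hlt
    exact (inv_lt_one₀ (by simp [zero_lt_iff, RatFunc.X_ne_zero])).mp hlt
  have hcard : Fintype.card (f.rootSet K) = 4 := card_rootSet_quarticPoly_X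
  obtain ⟨a⟩ : Nonempty (f.rootSet K) := Fintype.card_pos_iff.mp (by omega)
  have ha := root_quarticPoly_X a
  obtain ⟨ha1, ha4⟩ := Valuation.map_pow_four_of_one_lt Q.ring.valuation ht ha
  have h4 : 4 ∣ Nat.card I := hdvd (a : K)⁻¹ 4 (by rw [map_inv₀, map_inv₀, map_inv₀, ha4, inv_pow])
  refine ⟨h4.trans I.card_subgroup_dvd_card, ?_⟩
  have hfree {σ : K ≃ₐ[RatFunc E] K} (hσ : σ ∈ I) {b : f.rootSet K} (h : σ • b = b) : σ = 1 :=
    eq_one_of_isInertial_of_smul_eq (hI σ hσ) ht h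
  -- If `I` had exponent two, each nontrivial `σ ∈ I` would have `σ a / a ≡ -1`. This congruence
  -- determines `σ a`, hence `σ` by freeness, so `I` would have at most two elements although `4`
  -- divides its order.
  obtain ⟨σ, hσI, hσ⟩ : ∃ σ ∈ I, σ ^ 2 ≠ 1 := by
    by_contra! hinv
    have hneg {σ : K ≃ₐ[RatFunc E] K} (hσ : σ ∈ I) (h1 : σ ≠ 1) :
        Q.ring.valuation (σ a / a + 1) < 1 := by
      refine ((hI σ hσ).apply_div_of_involution ht ha (root_apply_quarticPoly_X σ a) ?_).resolve_left
        fun h ↦ h1 (hfree hσ (Subtype.ext h))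
      have := hinv σ hσ
      rw [pow_two] at this
      exact DFunLike.congr_fun this (a : K)
    have huniq {σ τ : K ≃ₐ[RatFunc E] K} (hσ : σ ∈ I) (h1 : σ ≠ 1) (hτ : τ ∈ I) (h1' : τ ≠ 1) :
        σ = τ := by
      have hs := hneg hσ h1
      have hlt := Valuation.map_sub_lt _ (hneg hτ h1') hs
      have hs1 : Q.ring.valuation (σ a / a) = 1 := by
        have : σ a / a = -(1 - (σ a / a + 1)) := by ring
        rw [this, Valuation.map_neg, Valuation.map_one_sub_of_lt _ hs]
      have ha0 : (a : K) ≠ 0 := by rintro h; simp [h] at ha1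
      have hσ0 : σ a ≠ 0 := by simpa using ha0
      have h : σ a = τ a := by
        refine Q.ring.root_quartic_eq_of_one_lt ht (root_apply_quarticPoly_X σ a)
          (root_apply_quarticPoly_X τ a) ?_
        have : τ a / σ a - 1 = ((τ a / a + 1) - (σ a / a + 1)) / (σ a / a) := by
          field_simp
          ring
        rwa [this, map_div₀, hs1, div_one]
      have h' : (σ⁻¹ * τ) • a = a := by
        rw [mul_smul, inv_smul_eq_iff]
        exact Subtype.ext h.symm
      have := hfree (mul_mem (inv_mem hσ) hτ) h'
      exact (inv_mul_eq_one.mp this)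
    have hle : Nat.card I ≤ 2 := by
      by_contra! hgt
      have : Nontrivial I := Finite.one_lt_card_iff_nontrivial.mp (by omega)
      obtain ⟨⟨σ, hσ⟩, h1⟩ := exists_ne (1 : I)
      have hsub : (Set.univ : Set I) ⊆ {1, ⟨σ, hσ⟩} := by
        rintro ⟨τ, hτ⟩ -
        by_cases hτ1 : τ = 1
        · exact .inl (Subtype.ext hτ1)
        · exact .inr (Subtype.ext (huniq hτ hτ1 hσ fun h ↦ h1 (Subtype.ext h)))
      have := Set.ncard_le_ncard hsub
      rw [Set.ncard_univ] at this
      have h2 := Set.ncard_insert_le (1 : I) {⟨σ, hσ⟩}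
      rw [Set.ncard_singleton] at h2
      omega
    have := Nat.le_of_dvd Nat.card_pos h4
    omega
  refine ⟨_, ⟨σ, rfl⟩, Equiv.Perm.sign_eq_neg_one_of_card_eq_four hcard _ (fun x hx ↦ ?_) ?_⟩
  · exact hσ (by rw [hfree hσI hx, one_pow])
  · rw [← map_pow, ← map_one (MulAction.toPermHom (K ≃ₐ[RatFunc E] K) (f.rootSet K))]
    exact fun h ↦ hσ (IsSplittingField.toPermHom_injective (f := f) h)

end CharThree

section Realization

variable (E K : Type*) [Field E] [Finite E] [Field K] [Algebra E K] [Algebra (RatFunc E) K]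
  [IsScalarTower E (RatFunc E) K] [CharP E 3]
  [(quarticPoly (RatFunc.X : RatFunc E)).IsSplittingField (RatFunc E) K]

theorem nonempty_algEquiv_mulEquiv_perm_four :
    Nonempty ((K ≃ₐ[RatFunc E] K) ≃* Equiv.Perm (Fin 4)) := by
  classical
  obtain ⟨_, _⟩ := isGalois_of_isSplittingField_quarticPoly_X E K
  set f := quarticPoly (RatFunc.X : RatFunc E) with hf
  have hinj := IsSplittingField.toPermHom_injective (f := f) (K := K)
  have hcard : Fintype.card (f.rootSet K) = 4 := card_rootSet_quarticPoly_X
  obtain ⟨h4, hodd⟩ := four_dvd_card_algEquiv_and_exists_sign E K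
  have hG := Nat.card_congr (MonoidHom.ofInjective hinj).toEquiv
  have htop := Subgroup.eq_top_of_card_eq_four hcard
    (MulAction.toPermHom (K ≃ₐ[RatFunc E] K) (f.rootSet K)).range
    (hG ▸ three_dvd_card_algEquiv E K) (hG ▸ h4) hodd
  exact ⟨(MulEquiv.ofBijective _ ⟨hinj, MonoidHom.range_eq_top.mp htop⟩).trans
    (Fintype.equivFinOfCardEq hcard).permCongrHom⟩

theorem finrank_of_isSplittingField_quarticPoly_X : Module.finrank (RatFunc E) K = 24 := by
  obtain ⟨_, _⟩ := isGalois_of_isSplittingField_quarticPoly_X E K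
  obtain ⟨e⟩ := nonempty_algEquiv_mulEquiv_perm_four E K
  rw [← IsGalois.card_aut_eq_finrank, Nat.card_congr e.toEquiv, Nat.card_eq_fintype_card,
    Fintype.card_perm, Fintype.card_fin]
  rfl

theorem isLgt1Realization_of_isSplittingField_quarticPoly_X :
    IsLgt1Realization E (Equiv.Perm (Fin 4)) K := by
  obtain ⟨_, _⟩ := isGalois_of_isSplittingField_quarticPoly_X E K
  obtain ⟨e⟩ := nonempty_algEquiv_mulEquiv_perm_four E K
  have : CharP K 3 := charP_of_injective_algebraMap (algebraMap E K).injective 3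
  refine isLgt1Realization_of_inertia (p := 3) e (isGeometricExtension_of_finrank_eq ?_)
    (fun Q σ hσ ht ↦ eq_one_of_isInertial_of_map_eq_one_of_char_three hσ ht)
    (fun Q σ hσ ht hσp ↦ eq_one_of_isInertial_of_pow_three_eq_one hσ ht hσp)
  intro L _ _ _ _ _ hX
  have : CharP L 3 := charP_of_injective_algebraMap (algebraMap E L).injective 3
  have : (quarticPoly (RatFunc.X : RatFunc L)).IsSplittingField (RatFunc L) K :=
    IsSplittingField.of_map_eq (k := RatFunc E) (f := quarticPoly (RatFunc.X : RatFunc E))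
      (by rw [map_quarticPoly, map_quarticPoly, hX])
  rw [finrank_of_isSplittingField_quarticPoly_X E K, finrank_of_isSplittingField_quarticPoly_X L K]

end Realization

/-! ### The discriminant -/

section Discriminant

theorem four_pow_of_charP {L : Type*} [Field L] {p : ℕ} [Fact p.Prime] [CharP L p] :
    (4 : L) ^ p = 4 := by
  rw [← frobenius_def]; exact map_ofNat (frobenius L p) 4

theorem three_pow_of_charP {L : Type*} [Field L] {p : ℕ} [Fact p.Prime] [CharP L p] :
    (3 : L) ^ p = 3 := by
  rw [← frobenius_def]; exact map_ofNat (frobenius L p) 3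

theorem Polynomial.Monic.prod_roots_sub {L : Type*} [Field L] {f : L[X]} (hf : f.Monic)
    (hs : f.Splits) (hdeg : Even f.natDegree) (c : L) :
    (f.roots.map fun a ↦ a - c).prod = f.eval c := by
  conv_rhs => rw [hs.eq_prod_roots_of_monic hf, eval_multiset_prod]
  rw [hs.natDegree_eq_card_roots] at hdeg
  have h : (f.roots.map fun a ↦ a - c) = f.roots.map fun a ↦ (-1) * (c - a) :=
    Multiset.map_congr rfl fun a _ ↦ by ring
  rw [h, Multiset.prod_map_mul, Multiset.map_const', Multiset.prod_replicate, hdeg.neg_one_pow,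
    one_mul, Multiset.map_map]
  simp

/-- Multiplying the derivative identity over all roots, with no signs because the degree is even,
gives `(∏ f'(a)) f(4) f(4/3) = f(0)^(p+2)`. As `c^p = c` for the constants involved, the three
values are `12`, `4/9` and `(4/9) t`. -/
theorem prod_eval_derivative_fiberPoly {L : Type*} [Field L] {p : ℕ} [Fact p.Prime] [CharP L p]
    (hp : 3 < p) {t : L} (hs : (fiberPoly p t).Splits) :
    ((fiberPoly p t).roots.map (fiberPoly p t).derivative.eval).prod = 4 / 243 * t ^ (p + 2) := by
  have hodd : Odd p := (Fact.out : p.Prime).eq_two_or_odd'.resolve_left (by omega)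
  have h2 : (2 : L) ≠ 0 := two_ne_zero_of_charP hp
  have h3 : (3 : L) ≠ 0 := three_ne_zero_of_charP hp
  have h4 : (4 : L) ≠ 0 := by
    rw [show (4 : L) = 2 * 2 by norm_num]; exact mul_ne_zero h2 h2
  have heven : Even (fiberPoly p t).natDegree := by
    rw [natDegree_fiberPoly hp]; exact hodd.add_odd odd_one
  have key (c : L) := (fiberPoly_monic hp t).prod_roots_sub hs heven c
  have hmul : ((fiberPoly p t).roots.map (fiberPoly p t).derivative.eval).prod *
      ((fiberPoly p t).eval 4 * (fiberPoly p t).eval (4 / 3)) =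
      (fiberPoly p t).eval 0 ^ (p + 2) := by
    rw [← key, ← key, ← key, ← Multiset.prod_map_mul, ← Multiset.prod_map_mul,
      ← Multiset.prod_map_pow]
    refine congrArg Multiset.prod (Multiset.map_congr rfl fun a ha ↦ ?_)
    rw [eval_derivative_fiberPoly hp (isRoot_of_mem_roots ha), sub_zero]
  obtain ⟨m, rfl⟩ : ∃ m, p = m + 2 := ⟨p - 2, by omega⟩
  have h4p : (4 : L) ^ (m + 2) = 4 := four_pow_of_charP
  have h3p : (3 : L) ^ (m + 2) = 3 := three_pow_of_charP
  have h9p : (9 : L) ^ (m + 2) = 9 := by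
    rw [show (9 : L) = 3 * 3 by norm_num, mul_pow, h3p]
  have h9 : (9 : L) ≠ 0 := by
    rw [show (9 : L) = 3 * 3 by norm_num]; exact mul_ne_zero h3 h3
  have h4m : (4 : L) ^ m = 1 / 4 := by
    rw [eq_div_iff h4]
    exact mul_right_cancel₀ h4 (by rw [one_mul, mul_assoc, ← pow_two, ← pow_add, h4p])
  have hm : Odd m := by rwa [Nat.odd_add, iff_true_right even_two] at hodd
  have e4 : (fiberPoly (m + 2) t).eval 4 = 12 := by
    rw [eval_fiberPoly, h4p, sub_self, zero_pow (by omega)]; ring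
  have e43 : (fiberPoly (m + 2) t).eval (4 / 3) = 4 / 9 := by
    rw [eval_fiberPoly, div_pow, h4p, h3p, sub_self, zero_pow two_ne_zero]
    field_simp
    ring
  have e0 : (fiberPoly (m + 2) t).eval 0 = 4 / 9 * t := by
    rw [eval_fiberPoly, zero_pow (by omega), zero_sub, zero_sub, zero_sub, Nat.add_sub_cancel,
      hm.neg_pow, h4m]
    field_simp
    ring
  rw [e4, e43, e0, mul_pow, pow_add (4 / 9), div_pow, h4p, h9p] at hmul
  have h12 : (12 : L) * (4 / 9) ≠ 0 := by
    rw [show (12 : L) = 3 * 4 by norm_num]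
    exact mul_ne_zero (mul_ne_zero h3 h4) (div_ne_zero h4 h9)
  have h243 : (243 : L) ≠ 0 := by
    rw [show (243 : L) = 3 ^ 5 by norm_num]; exact pow_ne_zero _ h3
  refine mul_right_cancel₀ h12 (hmul.trans ?_)
  have : (4 : L) / 9 * (4 / 9) ^ 2 = 4 / 243 * (12 * (4 / 9)) := by
    field_simp
    norm_num
  rw [this]
  ring

theorem resultant_derivative_realizingPoly {F : Type*} [Field F] {p : ℕ} [Fact p.Prime] [CharP F p]
    (hp : 3 < p) : (realizingPoly F p).resultant (realizingPoly F p).derivative (p + 1) p =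
      C (4 / 243) * X ^ (p + 2) := by
  let L := AlgebraicClosure (RatFunc F)
  let φ : F[X] →+* L := (algebraMap (RatFunc F) L).comp (algebraMap F[X] (RatFunc F))
  have hφ : Function.Injective φ :=
    (algebraMap (RatFunc F) L).injective.comp (IsFractionRing.injective F[X] (RatFunc F))
  have : CharP L p := charP_of_injective_algebraMap (R := F) (A := L) (algebraMap F L).injective p
  apply hφ
  have hs : (fiberPoly p (φ X)).Splits := IsAlgClosed.splits _
  have hdeg : (fiberPoly p (φ X)).derivative.natDegree ≤ p := by
    have := natDegree_derivative_le (fiberPoly p (φ X))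
    rwa [natDegree_fiberPoly hp] at this
  have h := resultant_eq_prod_eval (fiberPoly p (φ X)) (fiberPoly p (φ X)).derivative p hdeg hs
  rw [natDegree_fiberPoly hp, (fiberPoly_monic hp _).leadingCoeff, one_pow, one_mul,
    prod_eval_derivative_fiberPoly hp hs] at h
  rw [← resultant_map_map, ← derivative_map, map_realizingPoly, h, map_mul, map_pow]
  congr 1
  rw [← RingHom.comp_apply φ C, map_div₀, map_ofNat, map_ofNat]

theorem discr_realizingPoly {F : Type*} [Field F] {p : ℕ} [Fact p.Prime] [CharP F p]
    (hp : 3 < p) : (realizingPoly F p).discr =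
      C ((-1) ^ ((p + 1) / 2) * (4 / 243)) * X ^ (p + 2) := by
  have hodd : Odd p := (Fact.out : p.Prime).eq_two_or_odd'.resolve_left (by omega)
  have h := resultant_deriv (f := realizingPoly F p)
    (natDegree_pos_iff_degree_pos.mp (by rw [natDegree_realizingPoly F hp]; omega))
  rw [natDegree_realizingPoly F hp, Nat.add_sub_cancel, (realizingPoly_monic F hp).leadingCoeff,
    resultant_derivative_realizingPoly hp, mul_one] at h
  -- The exponents agree modulo `2`, since `p` is odd.
  have hsign : (-1 : F[X]) ^ ((p + 1) * p / 2) = (-1) ^ ((p + 1) / 2) := by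
    obtain ⟨m, rfl⟩ := hodd
    rw [show (2 * m + 1 + 1) * (2 * m + 1) = 2 * ((m + 1) * (2 * m + 1)) by ring,
      Nat.mul_div_cancel_left _ two_pos, show (2 * m + 1 + 1) / 2 = m + 1 by omega, pow_mul',
      Odd.neg_one_pow ⟨m, rfl⟩]
  rw [hsign] at h
  have hsq : ((-1 : F[X]) ^ ((p + 1) / 2)) * (-1) ^ ((p + 1) / 2) = 1 := by
    rw [← mul_pow]; simp
  rw [C_mul, C_pow, C_neg, C_1, mul_assoc, h, ← mul_assoc, hsq, one_mul]

end Discriminant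

theorem proposition3p1 (p : ℕ) [Fact p.Prime] (F : Type u) [Field F] [Finite F] [CharP F p] :
    (3 < p →
      (realizingPoly F p).discr = C ((-1) ^ ((p + 1) / 2) * (4 / 243)) * X ^ (p + 2) ∧
      (4 / 243 : F) ≠ 0 ∧
      (∀ (K : Type v) [Field K] [Algebra F K] [Algebra (RatFunc F) K]
        [IsScalarTower F (RatFunc F) K]
        [((realizingPoly F p).map (algebraMap F[X] (RatFunc F))).IsSplittingField (RatFunc F) K],
        IsLgt1Realization F (Equiv.Perm (Fin (p + 1))) K) ∧
      IsLgt1Realizable F (Equiv.Perm (Fin (p + 1)))) ∧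
    (p = 3 →
      ∀ (K : Type v) [Field K] [Algebra F K] [Algebra (RatFunc F) K]
        [IsScalarTower F (RatFunc F) K]
        [((realizingPolyThree F).map (algebraMap F[X] (RatFunc F))).IsSplittingField
          (RatFunc F) K],
        IsLgt1Realization F (Equiv.Perm (Fin 4)) K) := by
  refine ⟨fun hp ↦ ⟨discr_realizingPoly hp, ?_, ?_, ?_⟩, ?_⟩
  · have h2 : (2 : F) ≠ 0 := two_ne_zero_of_charP hp
    have h3 : (3 : F) ≠ 0 := three_ne_zero_of_charP hp
    rw [show (4 : F) = 2 ^ 2 by norm_num, show (243 : F) = 3 ^ 5 by norm_num]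
    exact div_ne_zero (pow_ne_zero _ h2) (pow_ne_zero _ h3)
  · intro K _ _ _ _ hK
    rw [map_realizingPoly, RatFunc.algebraMap_X] at hK
    exact isLgt1Realization_of_isSplittingField_fiberPoly_X hp
  · exact ⟨(fiberPoly p (RatFunc.X : RatFunc F)).SplittingField, inferInstance, inferInstance,
      inferInstance, inferInstance, isLgt1Realization_of_isSplittingField_fiberPoly_X hp⟩
  · rintro rfl K _ _ _ _ hK
    rw [map_realizingPolyThree, RatFunc.algebraMap_X] at hK
    exact isLgt1Realization_of_isSplittingField_quarticPoly_X F K
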